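/- Let $(T,\mu)$ be a probability space and $t_0>0$. Let $\nu$ be a locally finite Borel measure on $\mathbb{R}$ and let $\kappa:T\times[0,t_0]\to\mathbb{R}$, $\kappa_\tau(t)=\kappa(\tau,t)$, be jointly measurable. For a measurable function $k:[0,t_0]\to\mathbb R$, a *stopped solution* of the Jacobi equation $j''=k\,\nu\, j$ with standard initial conditions $j(0)=0$, $j'(0)=1$ is a function $j:[0,t_0]\to[0,\infty)$ for which there is $b\in(0,t_0]$ such that: $kj$ is $\nu$-integrable on $[0,b]$; $j(t)=\int_0^t v(u)\,du$ with $v(t)=1+\int_{[0,t]}k(u)j(u)\,d\nu(u)$ for $t\in[0,b]$; $j>0$ on $(0,b)$; $b=t_0$ or $j(b)=0$; and $j=0$ on $(b,t_0]$. (For $\nu$ Lebesgue measure this is the equation $j''(t)=k(t)j(t)$, with the solution held at zero after its first positive zero; general $\nu$ allows coefficients that are measures, such as Dirac impulses.) Let $\sigma:T\times[0,t_0]\to T$, $\sigma_t(\tau)=\sigma(\tau,t)$, be jointly measurable, with each $\sigma_t$ preserving $\mu$ (for instance a measure automorphism of $T$) and $\sigma_0=\mathrm{id}$. Let $j^0_\tau$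 and $j^\sigma_\tau$ be, for almost every $\tau\in T$, stopped solutions with coefficients $t\mapsto\kappa_\tau(t)$ and $t\mapsto\kappa_{\sigma_t(\tau)}(t)$ respectively (the existence of these solutions is assumed). Suppose the family is monotone: for all $\tau,\tau'\in T$, if $\kappa_\tau(s)>\kappa_{\tau'}(s)$ for some $s\in[0,t_0]$, then $\kappa_\tau(s)\ge\kappa_{\tau'}(s)$ for all $s\in[0,t_0]$. Then for all $s\in[0,t_0]$ and all real $p\ge1$, $$\int_T j^\sigma_\tau(s)^p\,d\mu(\tau)\ \le\ \int_T j^0_\tau(s)^p\,d\mu(\tau)\qquad\text{in }[0,\infty].$$ In particular (with $\nu$ Lebesgue measure), if $c:T\to\mathbb{R}$ is measurable, $j^0_\tau$ is the stopped solution of the constant-coefficient equation $j''=c(\tau)\,j$ and $j^\sigma_\tau$ that of $j''(t)=c(\sigma_t(\tau))\,j(t)$, for almost every $\tau$, then the same inequality holds for all $s\in[0,t_0]$ and all real $p\ge1$: the integrals are maximized by leaving the coefficients constant. -/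

import Mathlib

open MeasureTheory Set

noncomputable section

namespace JacobiShuffle

/-- `j`, with first derivative `v`, solves the Jacobi equation `j'' = κ j`, `j 0 = 0`, `j' 0 = 1`
on `[0, b]`, where the coefficient is the (signed) measure `κ = k · ν` with density `k` with respect
to the reference measure `ν`. For `ν = volume` the coefficient is the measurable function `k`, and
this is the usual (Carathéodory) notion of solution; for `ν` with atoms it allows Dirac impulses,
at which the (right-continuous) velocity `v` jumps by `k t * j t * ν {t}`. -/
structure SolvesJacobi (ν : Measure ℝ) (k : ℝ → ℝ) (b : ℝ) (j v : ℝ → ℝ) : Prop where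
  integrable : IntegrableOn (fun u => k u * j u) (Icc 0 b) ν
  velocity : ∀ t ∈ Icc 0 b, v t = 1 + ∫ u in Icc 0 t, k u * j u ∂ν
  position : ∀ t ∈ Icc 0 b, j t = ∫ u in (0 : ℝ)..t, v u

/-- `j` is the solution on `[0, t₀]` of the Jacobi equation with coefficient `k · ν` and standard
initial conditions, stopped at zero: it evolves by the equation up to its first positive zero `b`
(or up to `t₀`, if there is no zero before `t₀`) and vanishes from then on. -/
def IsStoppedSolution (ν : Measure ℝ) (k : ℝ → ℝ) (t₀ : ℝ) (j : ℝ → ℝ) : Prop :=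
  ∃ b ∈ Ioc 0 t₀, (∃ v : ℝ → ℝ, SolvesJacobi ν k b j v) ∧
    (∀ t ∈ Ioo 0 b, 0 < j t) ∧ (b = t₀ ∨ j b = 0) ∧ ∀ t ∈ Ioc b t₀, j t = 0

variable {T : Type*}

/-- A family of coefficients is monotone on `[0, t₀]` if any two of its members are ordered the
same way at all times. -/
def IsMonotoneFamily (t₀ : ℝ) (k : T → ℝ → ℝ) : Prop :=
  ∀ τ τ' : T, (∃ s ∈ Icc 0 t₀, k τ' s < k τ s) → ∀ s ∈ Icc 0 t₀, k τ' s ≤ k τ s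

/-- The shuffled coefficients `κ_{σ(t) τ}(t)`. -/
def shuffled (σ : ℝ → T → T) (k : T → ℝ → ℝ) : T → ℝ → ℝ :=
  fun τ t => k (σ t τ) t

variable [MeasurableSpace T]

/-- A time-dependent measurable family of measure-preserving maps of `T`, starting at the identity.
(Invertibility is not required.) -/
structure IsShuffle (μ : Measure T) (t₀ : ℝ) (σ : ℝ → T → T) : Prop where
  measurable : Measurable (fun x : T × ℝ => σ x.2 x.1)
  preserving : ∀ t ∈ Icc 0 t₀, MeasurePreserving (σ t) μ μ
  initial : σ 0 = id

/-- `j τ` is the stopped solution of the Jacobi equation with coefficient `k τ · ν`, for almost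
every `τ`. -/
def IsSolutionFamily (μ : Measure T) (ν : Measure ℝ) (t₀ : ℝ) (k j : T → ℝ → ℝ) : Prop :=
  ∀ᵐ τ ∂μ, IsStoppedSolution ν (k τ) t₀ (j τ)

/-- The total solution `∫_T j_τ(s)^p`, the integral of a nonnegative function, in `[0, ∞]`. -/
def Tot (μ : Measure T) (s p : ℝ) (j : T → ℝ → ℝ) : ENNReal :=
  ∫⁻ τ, ENNReal.ofReal (j τ s ^ p) ∂μ

end JacobiShuffle

end

/-
If `h` is a positive solution with coefficient `γ` and `j` solves the equation with a coefficient
above `γ`, then `j / h` solves a Volterra equation with a nonnegative kernel, so it is a Neumann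
series: a mixture, with positive weights, of products of the differences `k (σ u τ) u - γ u` at
different times. In a monotone family all these factors are increasing functions of one rank, and
among rearrangements of such functions those that leave the top sets aligned are the largest in
the increasing convex order. Comparing the mixtures gives the inequality for the `p`-th powers.

The comparison needs a member `h` below the others that is still positive at `s`, whereas some
members may have reached zero before. These contribute little when replaced by bases `h` with
`h s` arbitrarily small, obtained by mixing a dead solution, continued past its zero by reduction
of order, with a live one. If all members are dead at `s`, then so is almost every shuffled one.
-/

open MeasureTheory Set Filter Topology
open scoped ENNReal

noncomputable section

namespace JacobiShuffle

section Rearrangement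

/-- Weights `w : T → [0, 1]` that depend only on the rank `r`, equal to `1` above some level of `r`
and to `0` below it. These are the top sets of `r`, with the atoms of `r` split so that every mass
is attained. -/
structure IsThreshold {T : Type*} [MeasurableSpace T] (r : T → ℝ) (w : T → ℝ≥0∞) : Prop where
  measurable : Measurable w
  le_one : ∀ τ, w τ ≤ 1
  congr : ∀ τ τ', r τ = r τ' → w τ = w τ'
  eq_one : ∀ τ τ', r τ < r τ' → w τ ≠ 0 → w τ' = 1

/-- `f` is weakly majorized by `g`, when `g` is arranged along the rank `r`: the integral of `f`
over any set is at most the integral of `g` over a top set for `r` of the same measure. -/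
def RearrLE {T : Type*} [MeasurableSpace T] (μ : Measure T) (r : T → ℝ) (f g : T → ℝ≥0∞) : Prop :=
  ∀ E, MeasurableSet E → ∀ w, IsThreshold r w → ∫⁻ τ, w τ ∂μ = μ E →
    ∫⁻ τ in E, f τ ∂μ ≤ ∫⁻ τ, w τ * g τ ∂μ

lemma exists_measure_Ioi_le_le_measure_Ici (ρ : Measure ℝ) [IsProbabilityMeasure ρ] {m : ℝ≥0∞}
    (h0 : 0 < m) (h1 : m < 1) : ∃ c : ℝ, ρ (Ioi c) ≤ m ∧ m ≤ ρ (Ici c) := by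
  lift m to NNReal using h1.ne_top
  rw [ENNReal.coe_pos, ← NNReal.coe_pos] at h0
  rw [ENNReal.coe_lt_one_iff, ← NNReal.coe_lt_one] at h1
  set F := ProbabilityTheory.cdf ρ
  have top := ProbabilityTheory.tendsto_cdf_atTop ρ
  have bot := ProbabilityTheory.tendsto_cdf_atBot ρ
  set S : Set ℝ := {x | 1 - (m : ℝ) ≤ F x}
  have hne : S.Nonempty :=
    ((top.eventually (lt_mem_nhds (sub_lt_self 1 h0))).mono fun _ h => h.le).exists
  have hbdd : BddBelow S := by
    obtain ⟨x, hx⟩ := (bot.eventually (gt_mem_nhds (sub_pos.2 h1))).exists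
    exact ⟨x, fun y hy => le_of_not_gt fun h => ((F.mono h.le).trans_lt hx).not_ge hy⟩
  refine ⟨sInf S, ?_, ?_⟩
  · have hle : 1 - (m : ℝ) ≤ F (sInf S) := by
      rw [← F.iInf_Ioi_eq]
      refine le_ciInf fun x => ?_
      obtain ⟨y, hy, hyx⟩ := exists_lt_of_csInf_lt hne x.2
      exact le_trans hy (F.mono hyx.le)
    rw [← ProbabilityTheory.measure_cdf ρ, F.measure_Ioi top, ENNReal.ofReal_le_coe]
    linarith
  · have hle : Function.leftLim F (sInf S) ≤ 1 - m :=
      le_of_tendsto (F.mono.tendsto_leftLim _) <| by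
        filter_upwards [self_mem_nhdsWithin] with x hx
        exact (not_le.1 fun h => notMem_of_lt_csInf (s := S) hx hbdd h).le
    rw [← ProbabilityTheory.measure_cdf ρ, F.measure_Ici top, ← ENNReal.ofReal_coe_nnreal]
    exact ENNReal.ofReal_le_ofReal (by linarith)

lemma exists_mul_measure_singleton_eq (ρ : Measure ℝ) [IsFiniteMeasure ρ] {m : ℝ≥0∞} {c : ℝ}
    (h1 : ρ (Ioi c) ≤ m) (h2 : m ≤ ρ (Ici c)) : ∃ α ≤ 1, ρ (Ioi c) + α * ρ {c} = m := by
  have hIci : ρ (Ici c) = ρ (Ioi c) + ρ {c} := by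
    rw [← Ioi_union_left, measure_union (by simp) (measurableSet_singleton c)]
  rw [hIci] at h2
  refine ⟨(m - ρ (Ioi c)) / ρ {c},
    ENNReal.div_le_of_le_mul (by rwa [one_mul, tsub_le_iff_left]), ?_⟩
  rcases eq_or_ne (ρ {c}) 0 with h | h
  · rw [h, mul_zero, add_zero]
    exact h1.antisymm (by simpa [h] using h2)
  · rw [ENNReal.div_mul_cancel h (measure_ne_top _ _), add_tsub_cancel_of_le h1]

variable {T : Type*} [MeasurableSpace T] {μ : Measure T} {r : T → ℝ}

lemma isThreshold_comp_indicator (hr : Measurable r) (c : ℝ) {α : ℝ≥0∞} (hα : α ≤ 1) :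
    IsThreshold r fun τ =>
      (Ioi c).indicator 1 (r τ) + ({c} : Set ℝ).indicator (fun _ => α) (r τ) where
  measurable := ((measurable_one.indicator measurableSet_Ioi).add
    (measurable_const.indicator (measurableSet_singleton c))).comp hr
  le_one τ := by
    rcases lt_trichotomy (r τ) c with h | h | h
    · simp [h.ne, h.le]
    · simp [h, hα]
    · simp [h, h.ne']
  congr τ τ' h := by rw [h]
  eq_one τ τ' h hτ := by
    have hc : c ≤ r τ := by
      by_contra! hlt
      simp [hlt.ne, hlt.le] at hτ
    simp [hc.trans_lt h, (hc.trans_lt h).ne']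

lemma exists_isThreshold [IsProbabilityMeasure μ] (hr : Measurable r) {m : ℝ≥0∞} (h1 : m ≤ 1) :
    ∃ w, IsThreshold r w ∧ ∫⁻ τ, w τ ∂μ = m := by
  rcases eq_or_ne m 0 with rfl | h0
  · exact ⟨fun _ => 0, ⟨measurable_const, by simp, by simp, by simp⟩, by simp⟩
  rcases eq_or_lt_of_le h1 with rfl | h1
  · exact ⟨fun _ => 1, ⟨measurable_const, by simp, by simp, by simp⟩, by simp⟩
  have : IsProbabilityMeasure (μ.map r) := Measure.isProbabilityMeasure_map hr.aemeasurable
  obtain ⟨c, hc, hc'⟩ := exists_measure_Ioi_le_le_measure_Ici (μ.map r) (pos_iff_ne_zero.2 h0) h1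
  obtain ⟨α, hα, hm⟩ := exists_mul_measure_singleton_eq (μ.map r) hc hc'
  have hIoi : Measurable ((Ioi c).indicator (1 : ℝ → ℝ≥0∞)) :=
    measurable_one.indicator measurableSet_Ioi
  have hα' : Measurable (({c} : Set ℝ).indicator fun _ => α) :=
    measurable_const.indicator (measurableSet_singleton c)
  refine ⟨_, isThreshold_comp_indicator hr c hα, ?_⟩
  refine (lintegral_map (hIoi.add hα') hr).symm.trans ?_
  simp only [Pi.add_apply]
  rw [lintegral_add_left hIoi, lintegral_indicator_one measurableSet_Ioi,
    lintegral_indicator_const (measurableSet_singleton c), hm]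

lemma IsThreshold.le_or_le {w w' : T → ℝ≥0∞} (hw : IsThreshold r w) (hw' : IsThreshold r w') :
    w ≤ w' ∨ w' ≤ w := by
  by_contra! h
  obtain ⟨h1, h2⟩ := h
  simp only [Pi.le_def, not_forall, not_le] at h1 h2
  obtain ⟨τ, hτ⟩ := h1
  obtain ⟨τ', hτ'⟩ := h2
  rcases lt_trichotomy (r τ) (r τ') with h | h | h
  · exact hτ'.not_ge ((hw'.le_one τ').trans (hw.eq_one _ _ h (ne_bot_of_gt hτ)).ge)
  · exact hτ.not_gt (by rwa [hw.congr _ _ h, hw'.congr _ _ h])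
  · exact hτ.not_ge ((hw.le_one τ).trans (hw'.eq_one _ _ h (ne_bot_of_gt hτ')).ge)

lemma IsThreshold.ae_le {w w' : T → ℝ≥0∞} (hw : IsThreshold r w)
    (hw' : IsThreshold r w') (hfin : ∫⁻ τ, w τ ∂μ ≠ ∞) (h : ∫⁻ τ, w' τ ∂μ ≤ ∫⁻ τ, w τ ∂μ) :
    w' ≤ᵐ[μ] w := by
  rcases hw.le_or_le hw' with hle | hle
  · exact (ae_eq_of_ae_le_of_lintegral_le (.of_forall hle) hfin hw'.measurable.aemeasurable
      h).symm.le
  · exact .of_forall hle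

lemma IsThreshold.ae_le_indicator [IsFiniteMeasure μ] {w : T → ℝ≥0∞}
    (hw : IsThreshold r w) {V : Set T} (hV : MeasurableSet V)
    (hup : ∀ᵐ τ ∂μ, ∀ᵐ τ' ∂μ, τ ∉ V → τ' ∈ V → r τ < r τ') (h : ∫⁻ τ, w τ ∂μ ≤ μ V) :
    w ≤ᵐ[μ] V.indicator 1 := by
  by_cases hzero : ∀ᵐ τ ∂μ, τ ∉ V → w τ = 0
  · filter_upwards [hzero] with τ hτ
    by_cases hτV : τ ∈ V
    · simpa [hτV] using hw.le_one τ
    · simp [hτV, hτ hτV]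
  obtain ⟨τ, hτ, hτ'⟩ := ((not_eventually.1 hzero).and_eventually hup).exists
  push Not at hτ
  have hle : V.indicator 1 ≤ᵐ[μ] w := by
    filter_upwards [hτ'] with τ' hr
    by_cases hV' : τ' ∈ V
    · simp [hV', hw.eq_one _ _ (hr hτ.1 hV') hτ.2]
    · simp [hV']
  refine (ae_eq_of_ae_le_of_lintegral_le hle ?_ hw.measurable.aemeasurable ?_).symm.le
  · rw [lintegral_indicator_one hV]
    exact measure_ne_top _ _
  · rwa [lintegral_indicator_one hV]

lemma RearrLE.one : RearrLE μ r (fun _ => 1) (fun _ => 1) := by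
  intro E _ w _ h
  simp [h]

lemma RearrLE.const_mul {f g : T → ℝ≥0∞} (h : RearrLE μ r f g) (hf : Measurable f)
    (hg : Measurable g) (c : ℝ≥0∞) : RearrLE μ r (fun τ => c * f τ) (fun τ => c * g τ) := by
  intro E hE w hw hwE
  simp only [mul_left_comm _ c]
  rw [lintegral_const_mul _ hf,
    lintegral_const_mul c (f := fun τ => w τ * g τ) (hw.measurable.mul hg)]
  exact mul_le_mul_right (h E hE w hw hwE) c

lemma RearrLE.lintegral [SFinite μ] {α : Type*} [MeasurableSpace α] {ν : Measure α} [SFinite ν]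
    {f g : T → α → ℝ≥0∞} (hf : Measurable fun x : T × α => f x.1 x.2)
    (hg : Measurable fun x : T × α => g x.1 x.2)
    (h : ∀ᵐ u ∂ν, RearrLE μ r (fun τ => f τ u) (fun τ => g τ u)) :
    RearrLE μ r (fun τ => ∫⁻ u, f τ u ∂ν) (fun τ => ∫⁻ u, g τ u ∂ν) := by
  intro E hE w hw hwE
  calc ∫⁻ τ in E, ∫⁻ u, f τ u ∂ν ∂μ
      = ∫⁻ u, ∫⁻ τ in E, f τ u ∂μ ∂ν := lintegral_lintegral_swap hf.aemeasurable
    _ ≤ ∫⁻ u, ∫⁻ τ, w τ * g τ u ∂μ ∂ν := lintegral_mono_ae (h.mono fun u hu => hu E hE w hw hwE)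
    _ = ∫⁻ τ, ∫⁻ u, w τ * g τ u ∂ν ∂μ := lintegral_lintegral_swap
        ((hw.measurable.comp measurable_fst).mul hg).aemeasurable.prod_swap
    _ = ∫⁻ τ, w τ * ∫⁻ u, g τ u ∂ν ∂μ :=
        lintegral_congr fun τ => lintegral_const_mul _ (hg.comp measurable_prodMk_left)

lemma RearrLE.tsum {f g : ℕ → T → ℝ≥0∞} (hf : ∀ n, Measurable (f n))
    (hg : ∀ n, Measurable (g n)) (h : ∀ n, RearrLE μ r (f n) (g n)) :
    RearrLE μ r (fun τ => ∑' n, f n τ) (fun τ => ∑' n, g n τ) := by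
  intro E hE w hw hwE
  rw [lintegral_tsum fun n => (hf n).aemeasurable]
  simp_rw [← ENNReal.tsum_mul_left]
  rw [lintegral_tsum (f := fun n τ => w τ * g n τ)
    fun n => (hw.measurable.mul (hg n)).aemeasurable]
  exact ENNReal.tsum_le_tsum fun n => h n E hE w hw hwE

lemma RearrLE.indicator_preimage [IsProbabilityMeasure μ] {f g : T → ℝ≥0∞} (h : RearrLE μ r f g)
    (hr : Measurable r) {V : Set T} (hV : MeasurableSet V)
    (hup : ∀ᵐ τ ∂μ, ∀ᵐ τ' ∂μ, τ ∉ V → τ' ∈ V → r τ < r τ') {φ : T → T}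
    (hφ : MeasurePreserving φ μ μ) : RearrLE μ r ((φ ⁻¹' V).indicator f) (V.indicator g) := by
  intro E hE w hw hwE
  have hV' : MeasurableSet (φ ⁻¹' V) := hφ.measurable hV
  obtain ⟨w', hw', hw'E⟩ := exists_isThreshold (μ := μ) (m := μ (φ ⁻¹' V ∩ E)) hr prob_le_one
  have hw'w : w' ≤ᵐ[μ] w := hw.ae_le hw' (hwE ▸ measure_ne_top _ _)
    (hwE ▸ hw'E ▸ measure_mono inter_subset_right)
  have hw'V : w' ≤ᵐ[μ] V.indicator 1 := hw'.ae_le_indicator hV hup <| by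
    rw [hw'E, ← hφ.measure_preimage hV.nullMeasurableSet]
    exact measure_mono inter_subset_left
  calc ∫⁻ τ in E, (φ ⁻¹' V).indicator f τ ∂μ = ∫⁻ τ in φ ⁻¹' V ∩ E, f τ ∂μ := by
        rw [lintegral_indicator hV', Measure.restrict_restrict hV']
    _ ≤ ∫⁻ τ, w' τ * g τ ∂μ := h _ (hV'.inter hE) w' hw' hw'E
    _ ≤ ∫⁻ τ, w τ * V.indicator g τ ∂μ := by
        refine lintegral_mono_ae ?_
        filter_upwards [hw'w, hw'V] with τ h1 h2
        by_cases hτ : τ ∈ V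
        · simp only [hτ, indicator_of_mem]
          gcongr
        · have : w' τ = 0 := by simpa [hτ] using h2
          simp [this]

lemma ofReal_mul_eq_setLIntegral_indicator (x : ℝ) (c : ℝ≥0∞) :
    ENNReal.ofReal x * c = ∫⁻ a in Ioi 0, (Iio x).indicator (fun _ => c) a := by
  rw [lintegral_indicator_const measurableSet_Iio, Measure.restrict_apply measurableSet_Iio,
    inter_comm, Ioi_inter_Iio, Real.volume_Ioo, sub_zero, mul_comm]

-- Layer cake in `q` reduces the claim to indicators of the top sets `{a < q}`.
lemma RearrLE.mul_comp [IsProbabilityMeasure μ] {f g : T → ℝ≥0∞} (h : RearrLE μ r f g)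
    (hr : Measurable r) (hf : Measurable f) (hg : Measurable g) {q : T → ℝ} (hq : Measurable q)
    (hmono : ∀ᵐ τ ∂μ, ∀ᵐ τ' ∂μ, r τ' ≤ r τ → q τ' ≤ q τ) {φ : T → T}
    (hφ : MeasurePreserving φ μ μ) :
    RearrLE μ r (fun τ => ENNReal.ofReal (q (φ τ)) * f τ)
      (fun τ => ENNReal.ofReal (q τ) * g τ) := by
  have hmeas : ∀ (p : T → ℝ) (e : T → ℝ≥0∞), Measurable p → Measurable e →
      Measurable fun x : T × ℝ => (Iio (p x.1)).indicator (fun _ => e x.1) x.2 := fun p e hp he =>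
    (he.comp measurable_fst).indicator (measurableSet_lt measurable_snd (hp.comp measurable_fst))
  simp only [ofReal_mul_eq_setLIntegral_indicator]
  refine RearrLE.lintegral (hmeas _ f (hq.comp hφ.measurable) hf) (hmeas q g hq hg)
    (.of_forall fun a => ?_)
  refine h.indicator_preimage hr (measurableSet_lt measurable_const hq) ?_ hφ (V := {τ | a < q τ})
  filter_upwards [hmono] with τ hτ
  filter_upwards [hτ] with τ' hle hV hV'
  exact not_le.1 fun hr' => hV (lt_of_lt_of_le hV' (hle hr'))

lemma RearrLE.lintegral_sub_le [IsProbabilityMeasure μ] {f g : T → ℝ≥0∞} (h : RearrLE μ r f g)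
    (hr : Measurable r) (hf : Measurable f) {a : ℝ≥0∞} (ha : a ≠ ∞) :
    ∫⁻ τ, (f τ - a) ∂μ ≤ ∫⁻ τ, (g τ - a) ∂μ := by
  set E : Set T := {τ | a < f τ}
  have hE : MeasurableSet E := measurableSet_lt measurable_const hf
  obtain ⟨w, hw, hwE⟩ := exists_isThreshold (μ := μ) hr (m := μ E) prob_le_one
  have hsupp : ∫⁻ τ, (f τ - a) ∂μ = ∫⁻ τ in E, (f τ - a) ∂μ :=
    (setLIntegral_eq_of_support_subset fun τ hτ => tsub_pos_iff_lt.1 (pos_iff_ne_zero.2 hτ)).symm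
  refine (ENNReal.add_le_add_iff_right (ENNReal.mul_ne_top ha (measure_ne_top μ E))).1 ?_
  calc ∫⁻ τ, (f τ - a) ∂μ + a * μ E = ∫⁻ τ in E, (f τ - a + a) ∂μ := by
        rw [hsupp, lintegral_add_right _ measurable_const, setLIntegral_const]
    _ = ∫⁻ τ in E, f τ ∂μ :=
        setLIntegral_congr_fun hE fun τ hτ => tsub_add_cancel_of_le (le_of_lt hτ)
    _ ≤ ∫⁻ τ, w τ * g τ ∂μ := h E hE w hw hwE
    _ ≤ ∫⁻ τ, ((g τ - a) + a * w τ) ∂μ := lintegral_mono fun τ => by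
        calc w τ * g τ ≤ w τ * ((g τ - a) + a) := by gcongr; exact le_tsub_add
          _ = w τ * (g τ - a) + a * w τ := by ring
          _ ≤ (g τ - a) + a * w τ := by gcongr; exact mul_le_of_le_one_left' (hw.le_one τ)
    _ = ∫⁻ τ, (g τ - a) ∂μ + a * μ E := by
        rw [lintegral_add_right _ (hw.measurable.const_mul a), lintegral_const_mul _ hw.measurable,
          hwE]

end Rearrangement

section RpowLayerCake

variable {p : ℝ}

lemma ofReal_rpow_eq_lintegral_Ioc (hp : 1 < p) {y : ℝ} (hy : 0 ≤ y) :
    ENNReal.ofReal (y ^ p) =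
      ∫⁻ a in Ioc 0 y, ENNReal.ofReal (p * (p - 1) * a ^ (p - 2) * (y - a)) := by
  have hcont : ContinuousOn (fun a : ℝ => p * y * a ^ (p - 1) - (p - 1) * a ^ p) (Icc 0 y) :=
    ((Real.continuous_rpow_const (by linarith)).const_mul _ |>.sub
      ((Real.continuous_rpow_const (by linarith)).const_mul _)).continuousOn
  have hderiv : ∀ a ∈ Ioo 0 y, HasDerivAt (fun a : ℝ => p * y * a ^ (p - 1) - (p - 1) * a ^ p)
      (p * (p - 1) * a ^ (p - 2) * (y - a)) a := by
    intro a ha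
    refine (((Real.hasDerivAt_rpow_const (p := p - 1) (Or.inl ha.1.ne')).const_mul (p * y)).sub
      ((Real.hasDerivAt_rpow_const (p := p) (Or.inl ha.1.ne')).const_mul (p - 1))).congr_deriv ?_
    rw [show p - 1 - 1 = p - 2 by ring, show p - 1 = p - 2 + 1 by ring, Real.rpow_add_one ha.1.ne']
    ring
  have hnonneg : ∀ a ∈ Ioc 0 y, 0 ≤ p * (p - 1) * a ^ (p - 2) * (y - a) := fun a ha =>
    mul_nonneg (mul_nonneg (by nlinarith) (Real.rpow_nonneg ha.1.le _)) (sub_nonneg.2 ha.2)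
  have hint := intervalIntegral.integrableOn_deriv_of_nonneg hcont hderiv
    fun a ha => hnonneg a (Ioo_subset_Ioc_self ha)
  rw [← ofReal_integral_eq_lintegral_ofReal hint
      (ae_restrict_of_forall_mem measurableSet_Ioc hnonneg), ← intervalIntegral.integral_of_le hy,
    intervalIntegral.integral_eq_sub_of_hasDerivAt_of_le hy hcont hderiv
      ((intervalIntegrable_iff_integrableOn_Ioc_of_le hy).2 hint),
    Real.zero_rpow (by linarith), Real.zero_rpow (by linarith)]
  rcases hy.eq_or_lt with rfl | hy
  · simp [Real.zero_rpow (by linarith : p ≠ 0)]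
  · rw [mul_assoc, mul_comm y, ← Real.rpow_add_one hy.ne', sub_add_cancel]
    ring_nf

lemma rpow_eq_lintegral_sub (hp : 1 < p) (x : ℝ≥0∞) :
    x ^ p = ∫⁻ a in Ioi (0 : ℝ), ENNReal.ofReal (p * (p - 1) * a ^ (p - 2)) *
      (x - ENNReal.ofReal a) := by
  have hweight : ∀ a ∈ Ioi (0 : ℝ), 0 < p * (p - 1) * a ^ (p - 2) := fun a ha =>
    mul_pos (by nlinarith) (Real.rpow_pos_of_pos ha _)
  induction x with
  | top =>
    rw [setLIntegral_congr_fun (g := fun _ => ∞) measurableSet_Ioi fun a ha => by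
      simp [ENNReal.mul_top (ENNReal.ofReal_pos.2 (hweight a ha)).ne']]
    simp [ENNReal.top_rpow_of_pos (zero_lt_one.trans hp)]
  | coe x =>
    rw [← ENNReal.ofReal_coe_nnreal, ENNReal.ofReal_rpow_of_nonneg x.coe_nonneg (by linarith),
      ofReal_rpow_eq_lintegral_Ioc hp x.coe_nonneg, ← Ioc_union_Ioi_eq_Ioi x.coe_nonneg,
      lintegral_union measurableSet_Ioi (Ioc_disjoint_Ioi le_rfl),
      setLIntegral_eq_zero measurableSet_Ioi fun a ha => ?_, add_zero]
    · refine setLIntegral_congr_fun measurableSet_Ioc fun a ha => ?_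
      rw [ENNReal.ofReal_mul (hweight a ha.1).le, ENNReal.ofReal_sub _ ha.1.le]
    · rw [tsub_eq_zero_of_le (ENNReal.ofReal_le_ofReal (le_of_lt ha)), mul_zero, Pi.zero_apply]

variable {T : Type*} [MeasurableSpace T] {μ : Measure T} {r : T → ℝ}

lemma RearrLE.lintegral_rpow_le [IsProbabilityMeasure μ] {f g : T → ℝ≥0∞}
    (h : RearrLE μ r f g) (hr : Measurable r) (hf : Measurable f) (hg : Measurable g)
    (hp : 1 ≤ p) : ∫⁻ τ, f τ ^ p ∂μ ≤ ∫⁻ τ, g τ ^ p ∂μ := by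
  rcases eq_or_lt_of_le hp with rfl | hp
  · simpa using h.lintegral_sub_le hr hf ENNReal.zero_ne_top
  have hmeas : ∀ e : T → ℝ≥0∞, Measurable e → AEMeasurable (Function.uncurry fun τ (a : ℝ) =>
      ENNReal.ofReal (p * (p - 1) * a ^ (p - 2)) * (e τ - ENNReal.ofReal a))
      (μ.prod (volume.restrict (Ioi 0))) := fun e he =>
    (by fun_prop : Measurable fun x : T × ℝ =>
      ENNReal.ofReal (p * (p - 1) * x.2 ^ (p - 2)) * (e x.1 - ENNReal.ofReal x.2)).aemeasurable
  simp_rw [rpow_eq_lintegral_sub hp]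
  rw [lintegral_lintegral_swap (hmeas f hf), lintegral_lintegral_swap (hmeas g hg)]
  refine lintegral_mono fun a => ?_
  rw [lintegral_const_mul _ (by fun_prop), lintegral_const_mul _ (by fun_prop)]
  exact mul_le_mul_right (h.lintegral_sub_le hr hf ENNReal.ofReal_ne_top) _

end RpowLayerCake

section Neumann

/-- The terms of the Neumann series of the Volterra equation `y t = 1 + ∫ K t u * q u * y u ∂ν`,
with kernel `K` and the positive part of `q` as coefficient. -/
def neumann {α : Type*} [MeasurableSpace α] (ν : Measure α) (K : α → α → ℝ≥0∞) (q : α → ℝ) :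
    ℕ → α → ℝ≥0∞
  | 0, _ => 1
  | n + 1, t => ∫⁻ u, K t u * (ENNReal.ofReal (q u) * neumann ν K q n u) ∂ν

variable {α : Type*} [MeasurableSpace α] {ν : Measure α} {K : α → α → ℝ≥0∞}

lemma tsum_neumann_le {q : α → ℝ} {S : Set α} (hS : ∀ᵐ u ∂ν, u ∈ S) {z : α → ℝ≥0∞}
    (hm : ∀ n t, AEMeasurable (fun u => K t u * (ENNReal.ofReal (q u) * neumann ν K q n u)) ν)
    (hz : ∀ t ∈ S, 1 + ∫⁻ u, K t u * (ENNReal.ofReal (q u) * z u) ∂ν ≤ z t) {t : α}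
    (ht : t ∈ S) : ∑' n, neumann ν K q n t ≤ z t := by
  refine ENNReal.tsum_le_of_sum_range_le fun n => ?_
  induction n generalizing t with
  | zero => simp
  | succ n ih =>
    rw [Finset.sum_range_succ', add_comm]
    refine le_trans ?_ (hz t ht)
    simp only [neumann]
    gcongr
    rw [← lintegral_finsetSum' _ fun i _ => hm i t]
    refine lintegral_mono_ae ?_
    filter_upwards [hS] with u hu
    rw [← Finset.mul_sum, ← Finset.mul_sum]
    gcongr
    exact ih hu

lemma le_sum_neumann_add {q : α → ℝ} {S : Set α} (hS : ∀ᵐ u ∂ν, u ∈ S) {z : α → ℝ≥0∞}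
    {C : ℝ≥0∞} (hC : C ≠ ∞)
    (hm : ∀ n t, AEMeasurable (fun u => K t u * (ENNReal.ofReal (q u) * neumann ν K q n u)) ν)
    (hz : ∀ t ∈ S, z t ≤ 1 + ∫⁻ u, K t u * (ENNReal.ofReal (q u) * z u) ∂ν)
    (hb : ∀ t ∈ S, z t ≤ C) (n : ℕ) {t : α} (ht : t ∈ S) :
    z t ≤ ∑ i ∈ Finset.range n, neumann ν K q i t + C * neumann ν K q n t := by
  induction n generalizing t with
  | zero => simpa [neumann] using hb t ht
  | succ n ih =>
    refine (hz t ht).trans ?_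
    rw [Finset.sum_range_succ', add_comm (∑ i ∈ _, _), add_assoc]
    simp only [neumann]
    gcongr
    rw [← lintegral_finsetSum' _ fun i _ => hm i t, ← lintegral_const_mul' _ _ hC,
      ← lintegral_add_right' _ ((hm n t).const_mul C)]
    refine lintegral_mono_ae ?_
    filter_upwards [hS] with u hu
    calc K t u * (ENNReal.ofReal (q u) * z u)
        ≤ K t u * (ENNReal.ofReal (q u) *
          (∑ i ∈ Finset.range n, neumann ν K q i u + C * neumann ν K q n u)) := by
          gcongr; exact ih hu
      _ = _ := by rw [← Finset.mul_sum, ← Finset.mul_sum]; ring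

lemma le_tsum_neumann {q : α → ℝ} {S : Set α} (hS : ∀ᵐ u ∂ν, u ∈ S) {z : α → ℝ≥0∞}
    {C : ℝ≥0∞} (hC : C ≠ ∞)
    (hm : ∀ n t, AEMeasurable (fun u => K t u * (ENNReal.ofReal (q u) * neumann ν K q n u)) ν)
    (hz : ∀ t ∈ S, z t ≤ 1 + ∫⁻ u, K t u * (ENNReal.ofReal (q u) * z u) ∂ν)
    (hb : ∀ t ∈ S, z t ≤ C) {t : α} (ht : t ∈ S) : z t ≤ ∑' n, neumann ν K q n t := by
  by_cases htop : ∑' n, neumann ν K q n t = ∞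
  · rw [htop]
    exact le_top
  have hlim : Tendsto (fun n => ∑' i, neumann ν K q i t + C * neumann ν K q n t) atTop
      (𝓝 (∑' i, neumann ν K q i t + C * 0)) := tendsto_const_nhds.add <|
    ENNReal.Tendsto.const_mul (ENNReal.tendsto_atTop_zero_of_tsum_ne_top htop) (.inr hC)
  rw [mul_zero, add_zero] at hlim
  refine ge_of_tendsto' hlim fun n => (le_sum_neumann_add hS hC hm hz hb n ht).trans ?_
  gcongr
  exact ENNReal.sum_le_tsum _

variable {T : Type*} [MeasurableSpace T] {μ : Measure T} {r : T → ℝ}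

lemma measurable_neumann [SFinite ν] (hK : Measurable fun x : α × α => K x.1 x.2) {q : T → α → ℝ}
    (hq : Measurable fun x : T × α => q x.1 x.2) (n : ℕ) :
    Measurable fun x : T × α => neumann ν K (q x.1) n x.2 := by
  induction n with
  | zero => exact measurable_const
  | succ n ih =>
    simp only [neumann]
    refine Measurable.lintegral_prod_right' (f := fun z : (T × α) × α =>
      K z.1.2 z.2 * (ENNReal.ofReal (q z.1.1 z.2) * neumann ν K (q z.1.1) n z.2)) ?_
    have hu : Measurable fun z : (T × α) × α => (z.1.1, z.2) := by fun_prop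
    exact (hK.comp (f := fun z : (T × α) × α => (z.1.2, z.2)) (by fun_prop)).mul
      ((hq.comp hu).ennreal_ofReal.mul (ih.comp hu))

lemma rearrLE_neumann [IsProbabilityMeasure μ] [SFinite ν]
    (hK : Measurable fun x : α × α => K x.1 x.2) (hr : Measurable r)
    {q : T → α → ℝ} (hq : Measurable fun x : T × α => q x.1 x.2)
    (hmono : ∀ᵐ u ∂ν, ∀ᵐ τ ∂μ, ∀ᵐ τ' ∂μ, r τ' ≤ r τ → q τ' u ≤ q τ u)
    {σ : α → T → T} (hσ : Measurable fun x : T × α => σ x.2 x.1)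
    (hpres : ∀ᵐ u ∂ν, MeasurePreserving (σ u) μ μ) (n : ℕ) (t : α) :
    RearrLE μ r (fun τ => neumann ν K (fun u => q (σ u τ) u) n t)
      (fun τ => neumann ν K (q τ) n t) := by
  have hqσ : Measurable fun x : T × α => q (σ x.2 x.1) x.2 :=
    hq.comp (f := fun x : T × α => (σ x.2 x.1, x.2)) (hσ.prodMk measurable_snd)
  induction n generalizing t with
  | zero => exact RearrLE.one
  | succ n ih =>
    simp only [neumann]
    have hKt : Measurable fun x : T × α => K t x.2 :=
      hK.comp (f := fun x : T × α => (t, x.2)) (by fun_prop)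
    have hnσ := measurable_neumann (ν := ν) hK (q := fun τ u => q (σ u τ) u) hqσ n
    have hn := measurable_neumann (ν := ν) hK hq n
    refine RearrLE.lintegral (hKt.mul (hqσ.ennreal_ofReal.mul hnσ))
      (hKt.mul (hq.ennreal_ofReal.mul hn)) ?_
    filter_upwards [hmono, hpres] with u hu hpu
    have hsection : Measurable fun τ : T => (τ, u) := measurable_prodMk_right
    exact ((ih u).mul_comp hr (hnσ.comp hsection) (hn.comp hsection) (hq.comp hsection)
      hu hpu).const_mul ((hqσ.ennreal_ofReal.mul hnσ).comp hsection)
      ((hq.ennreal_ofReal.mul hn).comp hsection) _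

lemma lintegral_neumann_rpow_le [IsProbabilityMeasure μ] [SFinite ν]
    (hK : Measurable fun x : α × α => K x.1 x.2) (hr : Measurable r)
    {q : T → α → ℝ} (hq : Measurable fun x : T × α => q x.1 x.2)
    (hmono : ∀ᵐ u ∂ν, ∀ᵐ τ ∂μ, ∀ᵐ τ' ∂μ, r τ' ≤ r τ → q τ' u ≤ q τ u)
    {σ : α → T → T} (hσ : Measurable fun x : T × α => σ x.2 x.1)
    (hpres : ∀ᵐ u ∂ν, MeasurePreserving (σ u) μ μ) (t : α) {p : ℝ} (hp : 1 ≤ p) :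
    ∫⁻ τ, (∑' n, neumann ν K (fun u => q (σ u τ) u) n t) ^ p ∂μ ≤
      ∫⁻ τ, (∑' n, neumann ν K (q τ) n t) ^ p ∂μ := by
  have hqσ : Measurable fun x : T × α => q (σ x.2 x.1) x.2 :=
    hq.comp (f := fun x : T × α => (σ x.2 x.1, x.2)) (hσ.prodMk measurable_snd)
  have hnσ := fun n => (measurable_neumann (ν := ν) hK (q := fun τ u => q (σ u τ) u) hqσ n).comp
    (measurable_prodMk_right (y := t))
  have hn := fun n => (measurable_neumann (ν := ν) hK hq n).comp
    (measurable_prodMk_right (y := t))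
  exact (RearrLE.tsum hnσ hn fun n => rearrLE_neumann hK hr hq hmono hσ hpres n t).lintegral_rpow_le
    hr (Measurable.tsum hnσ) (Measurable.tsum hn) hp

end Neumann

section Motion

/-- The velocity at time `t` of a motion with unit initial velocity and acceleration `g · m`; an
atom of `m` at `t` already counts. -/
def vel (m : Measure ℝ) (g : ℝ → ℝ) (t : ℝ) : ℝ := 1 + ∫ u in Ioc 0 t, g u ∂m

/-- The position at time `t` of the motion with velocity `vel m g`, started at `0`. -/
def pos (m : Measure ℝ) (g : ℝ → ℝ) (t : ℝ) : ℝ := ∫ u in (0 : ℝ)..t, vel m g u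

/-- The Wronskian of the motions with accelerations `g₁ · m` and `g₂ · m`. -/
def wronskian (m : Measure ℝ) (g₁ g₂ : ℝ → ℝ) (t : ℝ) : ℝ :=
  vel m g₁ t * pos m g₂ t - pos m g₁ t * vel m g₂ t

variable {m : Measure ℝ} {g g₁ g₂ : ℝ → ℝ}

lemma continuousWithinAt_setIntegral_Ioc (hg : Integrable g m) (a t : ℝ) :
    ContinuousWithinAt (fun x => ∫ u in Ioc a x, g u ∂m) (Ici t) t := by
  simp_rw [← integral_indicator (measurableSet_Ioc (a := a))]
  refine continuousWithinAt_of_dominated (bound := fun u => ‖g u‖)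
    (.of_forall fun x => hg.aestronglyMeasurable.indicator measurableSet_Ioc)
    (.of_forall fun x => .of_forall fun u => norm_indicator_le_norm_self _ _)
    hg.norm (.of_forall fun u => ?_)
  refine continuousWithinAt_const.congr_of_eventuallyEq
    (f := fun _ => (Ioc a t).indicator g u) ?_ rfl
  rcases le_or_gt u t with hu | hu
  · filter_upwards [self_mem_nhdsWithin] with x (hx : t ≤ x)
    simp [indicator, hu, hu.trans hx]
  · filter_upwards [mem_nhdsWithin_of_mem_nhds (Iio_mem_nhds hu)] with x (hx : x < u)
    simp [indicator, hu.not_ge, hx.not_ge]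

lemma measurable_setIntegral_Ioc [SFinite m] (hg : AEStronglyMeasurable g m) (a : ℝ) :
    Measurable fun x => ∫ u in Ioc a x, g u ∂m := by
  have heq : ∀ x, ∫ u in Ioc a x, g u ∂m =
      ∫ u, {y : ℝ × ℝ | a < y.2 ∧ y.2 ≤ y.1}.indicator (fun y => hg.mk g y.2) (x, u) ∂m := by
    intro x
    rw [← integral_indicator measurableSet_Ioc]
    refine integral_congr_ae ?_
    filter_upwards [hg.ae_eq_mk] with u hu
    by_cases h : a < u ∧ u ≤ x <;> simp [indicator, h, hu]
  simp_rw [heq]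
  exact (((hg.stronglyMeasurable_mk.comp_measurable measurable_snd).indicator
    ((measurableSet_lt measurable_const measurable_snd).inter
      (measurableSet_le measurable_snd measurable_fst))).integral_prod_right').measurable

lemma abs_setIntegral_le (hg : Integrable g m) (S : Set ℝ) :
    |∫ u in S, g u ∂m| ≤ ∫ u, |g u| ∂m :=
  abs_integral_le_integral_abs.trans <|
    setIntegral_le_integral hg.abs (.of_forall fun _ => abs_nonneg _)

lemma vel_zero : vel m g 0 = 1 := by simp [vel]

lemma pos_zero : pos m g 0 = 0 := by simp [pos]

lemma vel_congr {t : ℝ} (h : ∀ u ∈ Ioc 0 t, g₁ u = g₂ u) : vel m g₁ t = vel m g₂ t :=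
  congrArg (1 + ·) (setIntegral_congr_fun measurableSet_Ioc h)

lemma pos_congr {t : ℝ} (ht : 0 ≤ t) (h : ∀ u ∈ Ioc 0 t, g₁ u = g₂ u) :
    pos m g₁ t = pos m g₂ t := by
  refine intervalIntegral.integral_congr fun r hr => vel_congr fun u hu => ?_
  rw [uIcc_of_le ht] at hr
  exact h u ⟨hu.1, hu.2.trans hr.2⟩

lemma measurable_vel [SFinite m] (hg : Integrable g m) : Measurable (vel m g) :=
  measurable_const.add (measurable_setIntegral_Ioc hg.aestronglyMeasurable 0)

lemma continuousWithinAt_vel (hg : Integrable g m) (t : ℝ) :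
    ContinuousWithinAt (vel m g) (Ici t) t :=
  continuousWithinAt_const.add (continuousWithinAt_setIntegral_Ioc hg 0 t)

lemma abs_vel_le (hg : Integrable g m) (t : ℝ) : |vel m g t| ≤ 1 + ∫ u, |g u| ∂m := by
  refine (abs_add_le _ _).trans ?_
  rw [abs_one]
  gcongr
  exact abs_setIntegral_le hg _

lemma intervalIntegrable_vel [SFinite m] (hg : Integrable g m) (a b : ℝ) :
    IntervalIntegrable (vel m g) volume a b :=
  (intervalIntegrable_const (c := 1 + ∫ u, |g u| ∂m)).mono_fun
    (measurable_vel hg).aestronglyMeasurable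
    (.of_forall fun t => (abs_vel_le hg t).trans (le_abs_self _))

lemma continuous_pos [SFinite m] (hg : Integrable g m) : Continuous (pos m g) :=
  intervalIntegral.continuous_primitive (intervalIntegrable_vel hg) 0

lemma hasDerivWithinAt_pos [SFinite m] (hg : Integrable g m) (t : ℝ) :
    HasDerivWithinAt (pos m g) (vel m g t) (Ioi t) t := by
  have : HasDerivWithinAt (pos m g) (vel m g t) (Ici t) t :=
    intervalIntegral.integral_hasDerivWithinAt_right (intervalIntegrable_vel hg 0 t)
      ((measurable_vel hg).stronglyMeasurable.stronglyMeasurableAtFilter)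
      ((continuousWithinAt_vel hg t).mono Ioi_subset_Ici_self)
  exact this.mono Ioi_subset_Ici_self

lemma abs_pos_le (hg : Integrable g m) {t : ℝ} (ht : 0 ≤ t) :
    |pos m g t| ≤ (1 + ∫ u, |g u| ∂m) * t := by
  have := intervalIntegral.norm_integral_le_of_norm_le_const (a := 0) (b := t)
    (f := vel m g) (C := 1 + ∫ u, |g u| ∂m) fun x _ => abs_vel_le hg x
  rwa [sub_zero, abs_of_nonneg ht, Real.norm_eq_abs] at this

lemma tendsto_pos_div_id [SFinite m] (hg : Integrable g m) :
    Tendsto (fun t => pos m g t / t) (𝓝[>] 0) (𝓝 1) := by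
  have hslope := (hasDerivWithinAt_iff_tendsto_slope' (by simp)).1 (hasDerivWithinAt_pos hg 0)
  rw [vel_zero] at hslope
  refine hslope.congr fun t => ?_
  rw [slope_def_field, pos_zero, sub_zero, sub_zero]

lemma tendsto_pos_div_pos [SFinite m] (hg₁ : Integrable g₁ m) (hg₂ : Integrable g₂ m) :
    Tendsto (fun t => pos m g₁ t / pos m g₂ t) (𝓝[>] 0) (𝓝 1) := by
  have hdiv := (tendsto_pos_div_id hg₁).div (tendsto_pos_div_id hg₂) one_ne_zero
  rw [div_one] at hdiv
  refine hdiv.congr' ?_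
  filter_upwards [self_mem_nhdsWithin] with t (ht : 0 < t)
  exact div_div_div_cancel_right₀ ht.ne' _ _

lemma exists_mul_le_pos [SFinite m] (hg : Integrable g m) {s : ℝ} (hs : 0 ≤ s)
    (h : ∀ t ∈ Ioc 0 s, 0 < pos m g t) : ∃ c > 0, ∀ t ∈ Ioc 0 s, c * t ≤ pos m g t := by
  set f := Function.update (fun t => pos m g t / t) 0 1
  have hf : ContinuousOn f (Icc 0 s) := by
    intro t ht
    rcases ht.1.eq_or_lt with rfl | ht0
    · refine continuousWithinAt_update_same.2 ((tendsto_pos_div_id hg).mono_left ?_)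
      exact nhdsWithin_mono _ fun x hx => hx.1.1.lt_of_ne' hx.2
    · exact (continuousWithinAt_update_of_ne ht0.ne').2
        ((continuous_pos hg).continuousWithinAt.div continuousWithinAt_id ht0.ne')
  have hfdiv : ∀ t ∈ Ioc 0 s, f t = pos m g t / t := fun t ht =>
    Function.update_of_ne ht.1.ne' _ _
  obtain ⟨x, hx, hmin⟩ := isCompact_Icc.exists_isMinOn (nonempty_Icc.2 hs) hf
  refine ⟨f x, ?_, fun t ht => ?_⟩
  · rcases hx.1.eq_or_lt with rfl | hx0
    · simp [f]
    · rw [hfdiv x ⟨hx0, hx.2⟩]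
      exact div_pos (h x ⟨hx0, hx.2⟩) hx0
  · rw [← le_div_iff₀ ht.1, ← hfdiv t ht]
    exact hmin (Ioc_subset_Icc_self ht)

lemma vel_eq_add_setIntegral (hg : Integrable g m) {a t : ℝ} (ha : 0 ≤ a) (hat : a ≤ t) :
    vel m g t = vel m g a + ∫ u in Ioc a t, g u ∂m := by
  rw [vel, vel, ← Ioc_union_Ioc_eq_Ioc ha hat, setIntegral_union (Ioc_disjoint_Ioc_of_le le_rfl)
    measurableSet_Ioc hg.integrableOn hg.integrableOn, add_assoc]

lemma setIntegral_triangle_swap [SFinite m] {φ : ℝ → ℝ} {a t : ℝ}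
    (hg : IntegrableOn g (Ioc a t) m) (hφ : IntegrableOn φ (Ioc a t)) :
    ∫ u in Ioc a t, g u * ∫ r in Ioc u t, φ r ∂volume ∂m =
      ∫ r in Ioc a t, φ r * ∫ u in Ioc a r, g u ∂m := by
  set F : ℝ → ℝ → ℝ := fun u r => {x : ℝ × ℝ | x.1 ≤ x.2}.indicator (fun x => g x.1 * φ x.2) (u, r)
  have hF : Integrable (Function.uncurry F)
      ((m.restrict (Ioc a t)).prod (volume.restrict (Ioc a t))) :=
    (hg.mul_prod hφ).indicator (measurableSet_le measurable_fst measurable_snd)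
  have hleft : ∀ u ∈ Ioc a t, g u * ∫ r in Ioc u t, φ r = ∫ r in Ioc a t, F u r := by
    intro u hu
    have hinter : Icc u t = Ici u ∩ Ioc a t := by grind
    rw [← integral_const_mul, ← integral_Icc_eq_integral_Ioc, hinter,
      ← Measure.restrict_restrict measurableSet_Ici, ← integral_indicator measurableSet_Ici]
    rfl
  have hright : ∀ r ∈ Ioc a t, φ r * ∫ u in Ioc a r, g u ∂m = ∫ u in Ioc a t, F u r ∂m := by
    intro r hr
    have hinter : Ioc a r = Iic r ∩ Ioc a t := by grind
    rw [← integral_const_mul, hinter, ← Measure.restrict_restrict measurableSet_Iic,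
      ← integral_indicator measurableSet_Iic]
    simp only [F, indicator, mem_Iic, mem_ofPred_eq, mul_comm]
  rw [setIntegral_congr_fun measurableSet_Ioc hleft, integral_integral_swap hF,
    setIntegral_congr_fun measurableSet_Ioc hright]

lemma vel_mul_eq [SFinite m] (hg : Integrable g m) {a t : ℝ} (ha : 0 ≤ a) (hat : a ≤ t)
    {φ Z : ℝ → ℝ} (hφ : IntegrableOn φ (Ioc a t))
    (hZ : ∀ u ∈ Icc a t, Z u = Z a + ∫ r in Ioc a u, φ r)
    (hgZ : IntegrableOn (fun u => g u * Z u) (Ioc a t) m) :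
    vel m g t * Z t = vel m g a * Z a + ∫ u in Ioc a t, g u * Z u ∂m +
      ∫ r in Ioc a t, vel m g r * φ r := by
  have hvφ : IntegrableOn (fun r => φ r * ∫ u in Ioc a r, g u ∂m) (Ioc a t) :=
    hφ.mul_bdd (measurable_setIntegral_Ioc hg.aestronglyMeasurable a).aestronglyMeasurable
      (.of_forall fun r => (Real.norm_eq_abs _).le.trans (abs_setIntegral_le hg _))
  have hincrement : ∀ u ∈ Ioc a t, g u * ∫ r in Ioc u t, φ r = g u * Z t - g u * Z u := by
    intro u hu
    rw [hZ t ⟨hat, le_rfl⟩, hZ u ⟨hu.1.le, hu.2⟩, ← Ioc_union_Ioc_eq_Ioc hu.1.le hu.2,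
      setIntegral_union (Ioc_disjoint_Ioc_of_le le_rfl) measurableSet_Ioc
        (hφ.mono_set (Ioc_subset_Ioc_right hu.2)) (hφ.mono_set (Ioc_subset_Ioc_left hu.1.le))]
    ring
  have hvel : ∫ r in Ioc a t, vel m g r * φ r =
      vel m g a * (∫ r in Ioc a t, φ r) + ∫ r in Ioc a t, φ r * ∫ u in Ioc a r, g u ∂m := by
    rw [← integral_const_mul, ← integral_add (hφ.const_mul _) hvφ]
    refine setIntegral_congr_fun measurableSet_Ioc fun r hr => ?_
    simp only [vel_eq_add_setIntegral hg ha hr.1.le]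
    ring
  rw [hvel, ← setIntegral_triangle_swap hg.integrableOn hφ,
    setIntegral_congr_fun measurableSet_Ioc hincrement, integral_sub (hg.restrict.mul_const _) hgZ,
    integral_mul_const, vel_eq_add_setIntegral hg ha hat]
  linear_combination vel m g a * hZ t ⟨hat, le_rfl⟩

lemma integrableOn_mul_continuousOn (hg : Integrable g m) {Z : ℝ → ℝ} {a b : ℝ}
    (hZ : ContinuousOn Z (Icc a b)) : IntegrableOn (fun u => g u * Z u) (Ioc a b) m := by
  obtain ⟨C, hC⟩ := isCompact_Icc.exists_bound_of_continuousOn hZ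
  exact hg.restrict.mul_bdd
    ((hZ.mono Ioc_subset_Icc_self).aestronglyMeasurable measurableSet_Ioc)
    (ae_restrict_of_forall_mem measurableSet_Ioc fun u hu => hC u (Ioc_subset_Icc_self hu))

lemma integrableOn_mul_pos [SFinite m] (hg₁ : Integrable g₁ m) (hg₂ : Integrable g₂ m) (t : ℝ) :
    IntegrableOn (fun u => g₁ u * pos m g₂ u) (Ioc 0 t) m :=
  integrableOn_mul_continuousOn hg₁ (continuous_pos hg₂).continuousOn

lemma vel_mul_pos [SFinite m] (hg₁ : Integrable g₁ m) (hg₂ : Integrable g₂ m) {t : ℝ}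
    (ht : 0 ≤ t) : vel m g₁ t * pos m g₂ t =
      ∫ u in Ioc 0 t, g₁ u * pos m g₂ u ∂m + ∫ r in Ioc 0 t, vel m g₁ r * vel m g₂ r := by
  rw [vel_mul_eq hg₁ le_rfl ht (φ := vel m g₂) (Z := pos m g₂)
    ((intervalIntegrable_iff_integrableOn_Ioc_of_le ht).1 (intervalIntegrable_vel hg₂ 0 t))
    (fun u hu => by rw [pos_zero, zero_add, pos, intervalIntegral.integral_of_le hu.1])
    (integrableOn_mul_pos hg₁ hg₂ t), pos_zero, mul_zero, zero_add]

lemma wronskian_eq_setIntegral [SFinite m] (hg₁ : Integrable g₁ m) (hg₂ : Integrable g₂ m) {t : ℝ}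
    (ht : 0 ≤ t) : wronskian m g₁ g₂ t =
      ∫ u in Ioc 0 t, (g₁ u * pos m g₂ u - g₂ u * pos m g₁ u) ∂m := by
  rw [integral_sub (integrableOn_mul_pos hg₁ hg₂ t) (integrableOn_mul_pos hg₂ hg₁ t), wronskian,
    mul_comm (pos m g₁ t), vel_mul_pos hg₁ hg₂ ht, vel_mul_pos hg₂ hg₁ ht]
  simp only [mul_comm (vel m g₂ _)]
  ring

lemma hasDerivWithinAt_pos_div_pos [SFinite m] (hg₁ : Integrable g₁ m) (hg₂ : Integrable g₂ m)
    {t : ℝ} (ht : pos m g₂ t ≠ 0) : HasDerivWithinAt (fun t => pos m g₁ t / pos m g₂ t)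
      (wronskian m g₁ g₂ t / pos m g₂ t ^ 2) (Ioi t) t :=
  (hasDerivWithinAt_pos hg₁ t).div (hasDerivWithinAt_pos hg₂ t) ht

lemma intervalIntegrable_wronskian_div [SFinite m] (hg₁ : Integrable g₁ m)
    (hg₂ : Integrable g₂ m) {a b : ℝ} (hab : a ≤ b) (h : ∀ t ∈ Icc a b, pos m g₂ t ≠ 0) :
    IntervalIntegrable (fun r => wronskian m g₁ g₂ r / pos m g₂ r ^ 2) volume a b := by
  have hW : IntervalIntegrable (wronskian m g₁ g₂) volume a b :=
    ((intervalIntegrable_vel hg₁ a b).mul_continuousOn (continuous_pos hg₂).continuousOn).sub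
      ((intervalIntegrable_vel hg₂ a b).continuousOn_mul (continuous_pos hg₁).continuousOn)
  simp only [div_eq_mul_inv]
  refine hW.mul_continuousOn ?_
  rw [uIcc_of_le hab]
  exact ((continuous_pos hg₂).pow 2).continuousOn.inv₀ fun t ht => pow_ne_zero 2 (h t ht)

lemma integral_wronskian_div [SFinite m] (hg₁ : Integrable g₁ m) (hg₂ : Integrable g₂ m)
    {a b : ℝ} (hab : a ≤ b) (h : ∀ t ∈ Icc a b, pos m g₂ t ≠ 0) :
    ∫ r in a..b, wronskian m g₁ g₂ r / pos m g₂ r ^ 2 =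
      pos m g₁ b / pos m g₂ b - pos m g₁ a / pos m g₂ a :=
  intervalIntegral.integral_eq_sub_of_hasDeriv_right_of_le hab
    ((continuous_pos hg₁).continuousOn.div (continuous_pos hg₂).continuousOn h)
    (fun t ht => hasDerivWithinAt_pos_div_pos hg₁ hg₂ (h t (Ioo_subset_Icc_self ht)))
    (intervalIntegrable_wronskian_div hg₁ hg₂ hab h)

end Motion

section Volterra

/-- The motion with acceleration `g · m` solves the Jacobi equation with coefficient `k · m` on
`(0, b]`. -/
structure IsSol (m : Measure ℝ) (k : ℝ → ℝ) (b : ℝ) (g : ℝ → ℝ) : Prop where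
  integrable : Integrable g m
  eq : ∀ u ∈ Ioc 0 b, g u = k u * pos m g u

/-- A solution of the Jacobi equation that is positive on `(0, s]`. -/
structure IsLive (m : Measure ℝ) (k : ℝ → ℝ) (s : ℝ) (g : ℝ → ℝ) : Prop extends
    IsSol m k s g where
  pos_pos : ∀ u ∈ Ioc 0 s, 0 < pos m g u

/-- The kernel of the Volterra equation satisfied by quotients by the solution `h`. -/
def kernel (h : ℝ → ℝ) (t u : ℝ) : ℝ≥0∞ := ∫⁻ r in Icc u t, ENNReal.ofReal (h u ^ 2 / h r ^ 2)

lemma kernel_of_lt {h : ℝ → ℝ} {t u : ℝ} (htu : t < u) : kernel h t u = 0 := by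
  simp [kernel, Icc_eq_empty (not_le.2 htu)]

lemma kernel_le_kernel {h : ℝ → ℝ} {t t' : ℝ} (ht : t ≤ t') (u : ℝ) :
    kernel h t u ≤ kernel h t' u :=
  lintegral_mono_set (Icc_subset_Icc_right ht)

lemma measurable_kernel {h : ℝ → ℝ} (hh : Measurable h) :
    Measurable fun x : ℝ × ℝ => kernel h x.1 x.2 := by
  have heq : (fun x : ℝ × ℝ => kernel h x.1 x.2) = fun x => ∫⁻ r,
      {y : (ℝ × ℝ) × ℝ | y.1.2 ≤ y.2 ∧ y.2 ≤ y.1.1}.indicator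
        (fun y => ENNReal.ofReal (h y.1.2 ^ 2 / h y.2 ^ 2)) (x, r) := by
    ext x
    rw [kernel, ← lintegral_indicator measurableSet_Icc]
    rfl
  rw [heq]
  refine (Measurable.indicator (by fun_prop) ?_).lintegral_prod_right'
  exact (measurableSet_le measurable_fst.snd measurable_snd).inter
    (measurableSet_le measurable_snd measurable_fst.fst)

lemma kernel_mul_eq {h : ℝ → ℝ} (hh : Measurable h) {t u : ℝ} (hu : 0 < u) (c : ℝ≥0∞) :
    kernel h t u * c = ∫⁻ r in Ioc 0 t, (Ici u).indicator
      (fun r => ENNReal.ofReal (1 / h r ^ 2) * (ENNReal.ofReal (h u ^ 2) * c)) r := by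
  have hinter : Icc u t = Ici u ∩ Ioc 0 t := by grind
  rw [lintegral_indicator measurableSet_Ici, Measure.restrict_restrict measurableSet_Ici,
    ← hinter, kernel, ← lintegral_mul_const _ (by fun_prop)]
  refine lintegral_congr fun r => ?_
  rw [← mul_assoc, ← ENNReal.ofReal_mul (by positivity), one_div_mul_eq_div]

lemma lintegral_kernel_mul {m : Measure ℝ} [SFinite m] (hm : ∀ᵐ u ∂m, 0 < u) {h : ℝ → ℝ}
    (hh : Measurable h) {F : ℝ → ℝ≥0∞} (hF : Measurable F) (t : ℝ) :
    ∫⁻ u, kernel h t u * F u ∂m = ∫⁻ r in Ioc 0 t, ENNReal.ofReal (1 / h r ^ 2) *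
      ∫⁻ u in Ioc 0 r, ENNReal.ofReal (h u ^ 2) * F u ∂m := by
  set G : ℝ → ℝ → ℝ≥0∞ := fun u r => {x : ℝ × ℝ | x.1 ≤ x.2}.indicator (fun x =>
    ENNReal.ofReal (1 / h x.2 ^ 2) * (ENNReal.ofReal (h x.1 ^ 2) * F x.1)) (u, r)
  have hG : Measurable (Function.uncurry G) :=
    Measurable.indicator (by fun_prop) (measurableSet_le measurable_fst measurable_snd)
  have hinner : ∀ r, ∫⁻ u, G u r ∂m = ENNReal.ofReal (1 / h r ^ 2) *
      ∫⁻ u in Ioc 0 r, ENNReal.ofReal (h u ^ 2) * F u ∂m := by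
    intro r
    have hIoc : Ioc 0 r =ᵐ[m] Iic r := by
      filter_upwards [hm] with u hu
      exact propext (and_iff_right hu)
    rw [← lintegral_const_mul _ (by fun_prop), setLIntegral_congr hIoc,
      ← lintegral_indicator measurableSet_Iic]
    rfl
  rw [← lintegral_congr hinner, ← lintegral_lintegral_swap hG.aemeasurable]
  refine lintegral_congr_ae ?_
  filter_upwards [hm] with u hu using kernel_mul_eq hh hu (F u)

lemma ofReal_integral_add_lintegral_neg {α : Type*} [MeasurableSpace α] {μ : Measure α}
    {f : α → ℝ} (hf : Integrable f μ) :
    ENNReal.ofReal (∫ x, f x ∂μ) + ∫⁻ x, ENNReal.ofReal (-f x) ∂μ =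
      ENNReal.ofReal (-∫ x, f x ∂μ) + ∫⁻ x, ENNReal.ofReal (f x) ∂μ := by
  have hpos : ∫⁻ x, ENNReal.ofReal (f x) ∂μ ≠ ∞ := hf.lintegral_lt_top.ne
  have hneg : ∫⁻ x, ENNReal.ofReal (-f x) ∂μ ≠ ∞ := hf.neg.lintegral_lt_top.ne
  rw [← ENNReal.toReal_eq_toReal_iff' (by finiteness) (by finiteness),
    ENNReal.toReal_add (by finiteness) hneg, ENNReal.toReal_add (by finiteness) hpos,
    ENNReal.toReal_ofReal', ENNReal.toReal_ofReal']
  linear_combination integral_eq_lintegral_pos_part_sub_lintegral_neg_part hf +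
    max_zero_sub_eq_self (∫ x, f x ∂μ)

lemma ofReal_add_ofReal_sub {x y : ℝ} (hx : 0 ≤ x) (hy : 0 ≤ y) :
    ENNReal.ofReal x + ENNReal.ofReal (y - x) = ENNReal.ofReal y + ENNReal.ofReal (x - y) := by
  rcases le_total x y with h | h
  · rw [← ENNReal.ofReal_add hx (sub_nonneg.2 h), ENNReal.ofReal_of_nonpos (sub_nonpos.2 h)]
    simp
  · rw [← ENNReal.ofReal_add hy (sub_nonneg.2 h), ENNReal.ofReal_of_nonpos (sub_nonpos.2 h)]
    simp

lemma monotone_setLIntegral_Ioc (m : Measure ℝ) (f : ℝ → ℝ≥0∞) :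
    Monotone fun r => ∫⁻ u in Ioc 0 r, f u ∂m :=
  fun _ _ h => lintegral_mono_set (Ioc_subset_Ioc_right h)

lemma ofReal_add_eq_ofReal_add_of_jordan {x y : ℝ} (hx : 0 ≤ x) (hy : 0 ≤ y)
    {P N A B : ℝ≥0∞} (hN : N ≠ ∞)
    (hdiff : ENNReal.ofReal (y - x) + N = ENNReal.ofReal (x - y) + P) (hPN : P + A = N + B) :
    ENNReal.ofReal y + A = ENNReal.ofReal x + B := by
  have hfin : ENNReal.ofReal (x - y) + N ≠ ∞ := ENNReal.add_ne_top.2 ⟨ENNReal.ofReal_ne_top, hN⟩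
  refine (ENNReal.add_left_inj hfin).1 ?_
  calc ENNReal.ofReal y + A + (ENNReal.ofReal (x - y) + N)
      = ENNReal.ofReal y + ENNReal.ofReal (x - y) + N + A := by ring
    _ = ENNReal.ofReal x + (ENNReal.ofReal (y - x) + N) + A := by
        rw [← ofReal_add_ofReal_sub hx hy, add_assoc (ENNReal.ofReal x)]
    _ = ENNReal.ofReal x + ENNReal.ofReal (x - y) + (P + A) := by rw [hdiff]; ring
    _ = ENNReal.ofReal x + B + (ENNReal.ofReal (x - y) + N) := by rw [hPN]; ring

section Ratio

variable {m : Measure ℝ} [SFinite m] {g₁ g₂ : ℝ → ℝ}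

lemma ofReal_wronskian_div_add (hg₁ : Integrable g₁ m) (hg₂ : Integrable g₂ m) {r : ℝ}
    (hr : 0 ≤ r) :
    ENNReal.ofReal (wronskian m g₁ g₂ r / pos m g₂ r ^ 2) + ENNReal.ofReal (1 / pos m g₂ r ^ 2) *
      ∫⁻ u in Ioc 0 r, ENNReal.ofReal (g₂ u * pos m g₁ u - g₁ u * pos m g₂ u) ∂m =
    ENNReal.ofReal (-(wronskian m g₁ g₂ r / pos m g₂ r ^ 2)) +
      ENNReal.ofReal (1 / pos m g₂ r ^ 2) *
      ∫⁻ u in Ioc 0 r, ENNReal.ofReal (g₁ u * pos m g₂ u - g₂ u * pos m g₁ u) ∂m := by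
  have hjordan := ofReal_integral_add_lintegral_neg
    ((integrableOn_mul_pos hg₁ hg₂ r).sub (integrableOn_mul_pos hg₂ hg₁ r))
  simp only [Pi.sub_apply, neg_sub, ← wronskian_eq_setIntegral hg₁ hg₂ hr] at hjordan
  rw [← neg_div, div_eq_mul_one_div, mul_comm, ENNReal.ofReal_mul (by positivity),
    div_eq_mul_one_div (-_), mul_comm (-_), ENNReal.ofReal_mul (by positivity), ← mul_add,
    ← mul_add, hjordan]

lemma ratio_add_lintegral_Ioc (hg₁ : Integrable g₁ m) (hg₂ : Integrable g₂ m) {ε t : ℝ}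
    (hε : 0 < ε) (hεt : ε ≤ t) (hpos₁ : ∀ r ∈ Icc ε t, 0 ≤ pos m g₁ r)
    (hpos₂ : ∀ r ∈ Icc ε t, 0 < pos m g₂ r) :
    ENNReal.ofReal (pos m g₁ t / pos m g₂ t) +
      ∫⁻ r in Ioc ε t, ENNReal.ofReal (1 / pos m g₂ r ^ 2) *
        ∫⁻ u in Ioc 0 r, ENNReal.ofReal (g₂ u * pos m g₁ u - g₁ u * pos m g₂ u) ∂m =
    ENNReal.ofReal (pos m g₁ ε / pos m g₂ ε) +
      ∫⁻ r in Ioc ε t, ENNReal.ofReal (1 / pos m g₂ r ^ 2) *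
        ∫⁻ u in Ioc 0 r, ENNReal.ofReal (g₁ u * pos m g₂ u - g₂ u * pos m g₁ u) ∂m := by
  set w : ℝ → ℝ := fun r => wronskian m g₁ g₂ r / pos m g₂ r ^ 2
  have hne : ∀ r ∈ Icc ε t, pos m g₂ r ≠ 0 := fun r hr => (hpos₂ r hr).ne'
  have hnn : ∀ r ∈ Icc ε t, 0 ≤ pos m g₁ r / pos m g₂ r :=
    fun r hr => div_nonneg (hpos₁ r hr) (hpos₂ r hr).le
  have hw : IntegrableOn w (Ioc ε t) := (intervalIntegrable_iff_integrableOn_Ioc_of_le hεt).1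
    (intervalIntegrable_wronskian_div hg₁ hg₂ hεt hne)
  have hwm : Measurable w := by
    have := measurable_vel hg₁
    have := measurable_vel hg₂
    have := (continuous_pos hg₁).measurable
    have := (continuous_pos hg₂).measurable
    unfold w wronskian
    fun_prop
  refine ofReal_add_eq_ofReal_add_of_jordan (hnn ε ⟨le_rfl, hεt⟩) (hnn t ⟨hεt, le_rfl⟩)
    (P := ∫⁻ r in Ioc ε t, ENNReal.ofReal (w r)) hw.neg.lintegral_lt_top.ne ?_ ?_
  · rw [← integral_wronskian_div hg₁ hg₂ hεt hne, ← neg_sub (pos m g₁ t / _),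
      ← integral_wronskian_div hg₁ hg₂ hεt hne, intervalIntegral.integral_of_le hεt]
    exact ofReal_integral_add_lintegral_neg hw
  · simp only [Pi.neg_apply]
    rw [← lintegral_add_left (by fun_prop), ← lintegral_add_left (by fun_prop)]
    exact setLIntegral_congr_fun measurableSet_Ioc fun r hr =>
      ofReal_wronskian_div_add hg₁ hg₂ (hε.trans hr.1).le

lemma tendsto_setLIntegral_Ioc {F : ℝ → ℝ≥0∞} (hF : Measurable F) (t : ℝ) :
    Tendsto (fun ε => ∫⁻ r in Ioc ε t, F r) (𝓝[>] 0) (𝓝 (∫⁻ r in Ioc 0 t, F r)) := by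
  have hcover : AECover (volume.restrict (Ioc 0 t)) (𝓝[>] (0 : ℝ)) fun ε => Ioc ε t :=
    aecover_Ioc_of_Ioc (tendsto_id.mono_left nhdsWithin_le_nhds) tendsto_const_nhds
  refine (hcover.lintegral_tendsto_of_countably_generated hF.aemeasurable).congr' ?_
  filter_upwards [self_mem_nhdsWithin] with ε (hε : 0 < ε)
  rw [Measure.restrict_restrict measurableSet_Ioc,
    inter_eq_left.2 (Ioc_subset_Ioc_left hε.le)]

lemma ratio_add_lintegral (hg₁ : Integrable g₁ m) (hg₂ : Integrable g₂ m) {t : ℝ} (ht : 0 < t)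
    (hpos₁ : ∀ r ∈ Ioc 0 t, 0 ≤ pos m g₁ r) (hpos₂ : ∀ r ∈ Ioc 0 t, 0 < pos m g₂ r) :
    ENNReal.ofReal (pos m g₁ t / pos m g₂ t) +
      ∫⁻ r in Ioc 0 t, ENNReal.ofReal (1 / pos m g₂ r ^ 2) *
        ∫⁻ u in Ioc 0 r, ENNReal.ofReal (g₂ u * pos m g₁ u - g₁ u * pos m g₂ u) ∂m =
    1 + ∫⁻ r in Ioc 0 t, ENNReal.ofReal (1 / pos m g₂ r ^ 2) *
        ∫⁻ u in Ioc 0 r, ENNReal.ofReal (g₁ u * pos m g₂ u - g₂ u * pos m g₁ u) ∂m := by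
  have hmeas : ∀ f : ℝ → ℝ≥0∞, Measurable fun r => ENNReal.ofReal (1 / pos m g₂ r ^ 2) *
      ∫⁻ u in Ioc 0 r, f u ∂m := fun f => by
    have := (continuous_pos hg₂).measurable
    have := (monotone_setLIntegral_Ioc m f).measurable
    fun_prop
  have hratio := ENNReal.tendsto_ofReal (tendsto_pos_div_pos hg₁ hg₂)
  rw [ENNReal.ofReal_one] at hratio
  refine tendsto_nhds_unique_of_eventuallyEq
    (tendsto_const_nhds.add (tendsto_setLIntegral_Ioc (hmeas _) t))
    (hratio.add (tendsto_setLIntegral_Ioc (hmeas _) t)) ?_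
  filter_upwards [Ioo_mem_nhdsGT ht] with ε hε
  exact ratio_add_lintegral_Ioc hg₁ hg₂ hε.1 hε.2.le
    (fun r hr => hpos₁ r ⟨hε.1.trans_le hr.1, hr.2⟩)
    (fun r hr => hpos₂ r ⟨hε.1.trans_le hr.1, hr.2⟩)

end Ratio

section Comparison

variable {m : Measure ℝ} {k γ : ℝ → ℝ} {b s : ℝ} {g h : ℝ → ℝ}

lemma ofReal_mul_pos_sub (hg : IsSol m k b g) (hh : IsLive m γ s h) (hbs : b ≤ s)
    (hnn : ∀ u ∈ Ioc 0 b, 0 ≤ pos m g u) {u : ℝ} (hu : u ∈ Ioc 0 b) :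
    ENNReal.ofReal (g u * pos m h u - h u * pos m g u) = ENNReal.ofReal (pos m h u ^ 2) *
      (ENNReal.ofReal (k u - γ u) * ENNReal.ofReal (pos m g u / pos m h u)) ∧
    ENNReal.ofReal (h u * pos m g u - g u * pos m h u) = ENNReal.ofReal (pos m h u ^ 2) *
      (ENNReal.ofReal (γ u - k u) * ENNReal.ofReal (pos m g u / pos m h u)) := by
  have hs : u ∈ Ioc 0 s := ⟨hu.1, hu.2.trans hbs⟩
  have hp := hh.pos_pos u hs
  have hratio : 0 ≤ pos m g u / pos m h u := div_nonneg (hnn u hu) hp.le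
  rw [← ENNReal.ofReal_mul' hratio, ← ENNReal.ofReal_mul (by positivity),
    ← ENNReal.ofReal_mul' hratio, ← ENNReal.ofReal_mul (by positivity), hg.eq u hu, hh.eq u hs]
  constructor <;> congr 1 <;> field_simp

variable [SFinite m]

lemma IsSol.ratio_add_lintegral_kernel (hm : ∀ᵐ u ∂m, 0 < u) (hk : Measurable k)
    (hγ : Measurable γ) (hg : IsSol m k b g) (hh : IsLive m γ s h) (hbs : b ≤ s)
    (hnn : ∀ u ∈ Ioc 0 b, 0 ≤ pos m g u) {t : ℝ} (ht : t ∈ Ioc 0 b) :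
    ENNReal.ofReal (pos m g t / pos m h t) + ∫⁻ u, kernel (pos m h) t u *
        (ENNReal.ofReal (γ u - k u) * ENNReal.ofReal (pos m g u / pos m h u)) ∂m =
      1 + ∫⁻ u, kernel (pos m h) t u *
        (ENNReal.ofReal (k u - γ u) * ENNReal.ofReal (pos m g u / pos m h u)) ∂m := by
  have hgm := (continuous_pos hg.integrable).measurable
  have hhm := (continuous_pos hh.integrable).measurable
  have hsub : ∀ r ∈ Ioc 0 t, r ∈ Ioc 0 b := fun r hr => ⟨hr.1, hr.2.trans ht.2⟩
  rw [lintegral_kernel_mul hm hhm (by fun_prop), lintegral_kernel_mul hm hhm (by fun_prop)]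
  convert ratio_add_lintegral hg.integrable hh.integrable ht.1 (fun r hr => hnn r (hsub r hr))
    (fun r hr => hh.pos_pos r ⟨hr.1, (hsub r hr).2.trans hbs⟩) using 2
  all_goals
    refine setLIntegral_congr_fun measurableSet_Ioc fun r hr => ?_
    congr 1
    refine setLIntegral_congr_fun measurableSet_Ioc fun u hu => ?_
    have hu' := hsub u ⟨hu.1, hu.2.trans hr.2⟩
    simp only [ofReal_mul_pos_sub hg hh hbs hnn hu']

lemma IsSol.ratio_le (hm : ∀ᵐ u ∂m, 0 < u) (hk : Measurable k) (hγ : Measurable γ)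
    (hg : IsSol m k b g) (hh : IsLive m γ s h) (hbs : b ≤ s)
    (hnn : ∀ u ∈ Ioc 0 b, 0 ≤ pos m g u) {t : ℝ} (ht : t ∈ Ioc 0 b) :
    ENNReal.ofReal (pos m g t / pos m h t) ≤ 1 + ∫⁻ u, kernel (pos m h) t u *
      (ENNReal.ofReal (k u - γ u) * ENNReal.ofReal (pos m g u / pos m h u)) ∂m :=
  le_self_add.trans_eq (hg.ratio_add_lintegral_kernel hm hk hγ hh hbs hnn ht)

lemma IsSol.ratio_eq (hm : ∀ᵐ u ∂m, 0 < u) (hk : Measurable k) (hγ : Measurable γ)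
    (hg : IsSol m k b g) (hh : IsLive m γ s h) (hbs : b ≤ s)
    (hnn : ∀ u ∈ Ioc 0 b, 0 ≤ pos m g u) (hle : ∀ᵐ u ∂m, u ∈ Ioc 0 b → γ u ≤ k u)
    {t : ℝ} (ht : t ∈ Ioc 0 b) :
    ENNReal.ofReal (pos m g t / pos m h t) = 1 + ∫⁻ u, kernel (pos m h) t u *
      (ENNReal.ofReal (k u - γ u) * ENNReal.ofReal (pos m g u / pos m h u)) ∂m := by
  suffices hzero : ∫⁻ u, kernel (pos m h) t u *
      (ENNReal.ofReal (γ u - k u) * ENNReal.ofReal (pos m g u / pos m h u)) ∂m = 0 by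
    rw [← hg.ratio_add_lintegral_kernel hm hk hγ hh hbs hnn ht, hzero, add_zero]
  refine lintegral_eq_zero_of_ae_eq_zero ?_
  filter_upwards [hm, hle] with u hu hγk
  rcases le_or_gt u t with hut | hut
  · simp [ENNReal.ofReal_of_nonpos (sub_nonpos.2 (hγk ⟨hu, hut.trans ht.2⟩))]
  · simp [kernel_of_lt hut]

lemma IsSol.pos_le_pos (hm : ∀ᵐ u ∂m, 0 < u) (hk : Measurable k) (hγ : Measurable γ)
    (hg : IsSol m k b g) (hh : IsLive m γ s h) (hbs : b ≤ s)
    (hnn : ∀ u ∈ Ioc 0 b, 0 ≤ pos m g u) (hle : ∀ᵐ u ∂m, u ∈ Ioc 0 b → γ u ≤ k u)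
    {t : ℝ} (ht : t ∈ Ioc 0 b) : pos m h t ≤ pos m g t := by
  have hratio : 1 ≤ ENNReal.ofReal (pos m g t / pos m h t) :=
    le_self_add.trans_eq (hg.ratio_eq hm hk hγ hh hbs hnn hle ht).symm
  rwa [ENNReal.one_le_ofReal, one_le_div (hh.pos_pos t ⟨ht.1, ht.2.trans hbs⟩)] at hratio

end Comparison

end Volterra

section Stopped

/-- `j` coincides on `(0, s]` with the motion `pos m g`, which solves the Jacobi equation with
coefficient `k · m`, stopped at its first zero `b`. -/
structure StoppedAt (m : Measure ℝ) (k : ℝ → ℝ) (s : ℝ) (j : ℝ → ℝ) (b : ℝ) (g : ℝ → ℝ) :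
    Prop where
  mem : b ∈ Ioc 0 s
  sol : IsSol m k b g
  eq : ∀ u ∈ Ioc 0 b, j u = pos m g u
  pos_pos : ∀ u ∈ Ioo 0 b, 0 < pos m g u
  endpoint : b = s ∨ pos m g b = 0
  after : ∀ u ∈ Ioc b s, j u = 0

/-- `j` is a solution on `(0, s]` of the Jacobi equation with coefficient `k · m`, stopped at its
first zero. -/
def IsStopped (m : Measure ℝ) (k : ℝ → ℝ) (s : ℝ) (j : ℝ → ℝ) : Prop :=
  ∃ b g, StoppedAt m k s j b g

section Existence

variable {ν : Measure ℝ} {k j v : ℝ → ℝ} {b b₀ s : ℝ}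

lemma SolvesJacobi.integrable_indicator (h : SolvesJacobi ν k b₀ j v) (hb : b ≤ b₀) :
    Integrable ((Ioc 0 b).indicator fun u => k u * j u) (ν.restrict (Ioc 0 s)) := by
  rw [integrable_indicator_iff measurableSet_Ioc]
  exact (h.integrable.mono_set ((Ioc_subset_Ioc_right hb).trans Ioc_subset_Icc_self)).mono_measure
    Measure.restrict_le_self

lemma SolvesJacobi.vel_eq (h : SolvesJacobi ν k b₀ j v) (hb : b ≤ b₀) (hbs : b ≤ s) {t : ℝ}
    (ht : t ∈ Icc 0 b) :
    vel (ν.restrict (Ioc 0 s)) ((Ioc 0 b).indicator fun u => k u * j u) t = v t := by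
  have hj0 : j 0 = 0 := by
    rw [h.position 0 ⟨le_rfl, ht.1.trans (ht.2.trans hb)⟩, intervalIntegral.integral_same]
  rw [h.velocity t ⟨ht.1, ht.2.trans hb⟩, vel, Measure.restrict_restrict measurableSet_Ioc,
    inter_eq_left.2 (Ioc_subset_Ioc_right (ht.2.trans hbs)),
    setIntegral_indicator measurableSet_Ioc, inter_eq_left.2 (Ioc_subset_Ioc_right ht.2)]
  congr 1
  refine (setIntegral_eq_of_subset_of_forall_sdiff_eq_zero measurableSet_Icc
    Ioc_subset_Icc_self fun u hu => ?_).symm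
  obtain rfl : u = 0 := by grind
  rw [hj0, mul_zero]

lemma SolvesJacobi.pos_eq (h : SolvesJacobi ν k b₀ j v) (hb : b ≤ b₀) (hbs : b ≤ s) {t : ℝ}
    (ht : t ∈ Icc 0 b) :
    pos (ν.restrict (Ioc 0 s)) ((Ioc 0 b).indicator fun u => k u * j u) t = j t := by
  rw [h.position t ⟨ht.1, ht.2.trans hb⟩, pos]
  refine intervalIntegral.integral_congr fun u hu => ?_
  rw [uIcc_of_le ht.1] at hu
  exact h.vel_eq hb hbs ⟨hu.1, hu.2.trans ht.2⟩

lemma IsStoppedSolution.isStopped {t₀ : ℝ} (h : IsStoppedSolution ν k t₀ j)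
    (hs : s ∈ Ioc 0 t₀) : IsStopped (ν.restrict (Ioc 0 s)) k s j := by
  obtain ⟨b₀, hb₀, ⟨v, hsol⟩, hpos, hlast, hafter⟩ := h
  set b := min b₀ s
  have hb0 : 0 < b := lt_min hb₀.1 hs.1
  have hbb : b ≤ b₀ := min_le_left _ _
  have hbs : b ≤ s := min_le_right _ _
  have heq : ∀ t ∈ Icc 0 b, _ = j t := fun t ht => hsol.pos_eq hbb hbs ht
  refine ⟨b, _, ⟨hb0, hbs⟩, ⟨hsol.integrable_indicator hbb, fun u hu => ?_⟩,
    fun u hu => (heq u (Ioc_subset_Icc_self hu)).symm, fun u hu => ?_, ?_, fun u hu => ?_⟩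
  · rw [heq u (Ioc_subset_Icc_self hu), indicator_of_mem hu]
  · rw [heq u (Ioo_subset_Icc_self hu)]
    exact hpos u ⟨hu.1, hu.2.trans_le hbb⟩
  · rw [heq b ⟨hb0.le, le_rfl⟩]
    rcases le_total s b₀ with hsb | hbs'
    · exact .inl (min_eq_right hsb)
    · have hbe : b = b₀ := min_eq_left hbs'
      rw [hbe]
      exact hlast.imp_left fun h => hbs'.antisymm (hs.2.trans_eq h.symm)
  · rcases min_lt_iff.1 hu.1 with hbu | hsu
    · exact hafter u ⟨hbu, hu.2.trans hs.2⟩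
    · exact absurd hu.2 hsu.not_ge

end Existence

variable {m : Measure ℝ} {k γ : ℝ → ℝ} {s b : ℝ} {j g h : ℝ → ℝ}

lemma StoppedAt.eq_end (hj : StoppedAt m k s j b g) (h : 0 < j s) : b = s := by
  by_contra hne
  exact h.ne' (hj.after s ⟨hj.mem.2.lt_of_ne hne, le_rfl⟩)

lemma StoppedAt.isLive (hj : StoppedAt m k s j b g) (h : 0 < j s) : IsLive m k s g := by
  obtain rfl := hj.eq_end h
  refine ⟨hj.sol, fun u hu => ?_⟩
  rcases hu.2.eq_or_lt with rfl | hlt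
  · rwa [← hj.eq u hu]
  · exact hj.pos_pos u ⟨hu.1, hlt⟩

lemma StoppedAt.pos_end_eq_zero (hj : StoppedAt m k s j b g) (h : j s = 0) : pos m g b = 0 := by
  rcases hj.endpoint with rfl | hzero
  · rw [← hj.eq b ⟨hj.mem.1, le_rfl⟩, h]
  · exact hzero

lemma IsStopped.exists_isLive (hj : IsStopped m k s j) (hpos : 0 < j s) :
    ∃ g, IsLive m k s g ∧ j s = pos m g s := by
  obtain ⟨b, g, hg⟩ := hj
  exact ⟨g, hg.isLive hpos, hg.eq s ⟨hg.mem.1.trans_le hg.mem.2, (hg.eq_end hpos).ge⟩⟩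

lemma tsum_neumann_eq_one {K : ℝ → ℝ → ℝ≥0∞} {q : ℝ → ℝ} (hq : ∀ᵐ u ∂m, q u ≤ 0) (t : ℝ) :
    ∑' n, neumann m K q n t = 1 := by
  refine (tsum_eq_single 0 fun n hn => ?_).trans rfl
  obtain ⟨n, rfl⟩ := Nat.exists_eq_succ_of_ne_zero hn
  refine lintegral_eq_zero_of_ae_eq_zero ?_
  filter_upwards [hq] with u hu
  simp [ENNReal.ofReal_of_nonpos hu]

variable [SFinite m]

lemma StoppedAt.pos_nonneg (hj : StoppedAt m k s j b g) : ∀ u ∈ Ioc 0 b, 0 ≤ pos m g u := by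
  have hclosure : closure (Ioo 0 b) ⊆ {u | 0 ≤ pos m g u} :=
    closure_minimal (fun u hu => (hj.pos_pos u hu).le)
      (isClosed_le continuous_const (continuous_pos hj.sol.integrable))
  rw [closure_Ioo hj.mem.1.ne] at hclosure
  exact fun u hu => hclosure (Ioc_subset_Icc_self hu)

lemma StoppedAt.nonneg (hj : StoppedAt m k s j b g) {u : ℝ} (hu : u ∈ Ioc 0 s) : 0 ≤ j u := by
  rcases le_or_gt u b with h | h
  · rw [hj.eq u ⟨hu.1, h⟩]
    exact hj.pos_nonneg u ⟨hu.1, h⟩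
  · exact (hj.after u ⟨h, hu.2⟩).ge

lemma StoppedAt.pos_of_isLive (hm : ∀ᵐ u ∂m, u ∈ Ioc 0 s) (hk : Measurable k)
    (hγ : Measurable γ) (hj : StoppedAt m k s j b g) (hh : IsLive m γ s h)
    (hle : ∀ᵐ u ∂m, γ u ≤ k u) : 0 < j s := by
  have hpb : 0 < pos m g b := (hh.pos_pos b hj.mem).trans_le <|
    hj.sol.pos_le_pos (hm.mono fun u hu => hu.1) hk hγ hh hj.mem.2 hj.pos_nonneg
      (hle.mono fun u hu _ => hu) ⟨hj.mem.1, le_rfl⟩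
  rcases hj.endpoint with rfl | hzero
  · rwa [hj.eq b ⟨hj.mem.1, le_rfl⟩]
  · exact absurd hzero hpb.ne'

lemma aemeasurable_neumann_integrand (hh : Integrable h m) {q : ℝ → ℝ} (hq : Measurable q)
    (n : ℕ) (t : ℝ) : AEMeasurable (fun u => kernel (pos m h) t u *
      (ENNReal.ofReal (q u) * neumann m (kernel (pos m h)) q n u)) m := by
  have hK := measurable_kernel (continuous_pos hh).measurable
  have hn : Measurable fun u => neumann m (kernel (pos m h)) q n u :=
    (measurable_neumann (T := Unit) (q := fun _ => q) hK (hq.comp measurable_snd) n).comp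
      (measurable_prodMk_left (x := ()))
  exact ((hK.comp measurable_prodMk_left).mul (hq.ennreal_ofReal.mul hn)).aemeasurable

lemma StoppedAt.ratio_le (hm : ∀ᵐ u ∂m, u ∈ Ioc 0 s) (hk : Measurable k) (hγ : Measurable γ)
    (hj : StoppedAt m k s j b g) (hh : IsLive m γ s h) {t : ℝ} (ht : t ∈ Ioc 0 s) :
    ENNReal.ofReal (j t / pos m h t) ≤ 1 + ∫⁻ u, kernel (pos m h) t u *
      (ENNReal.ofReal (k u - γ u) * ENNReal.ofReal (j u / pos m h u)) ∂m := by
  rcases le_or_gt t b with htb | htb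
  · rw [hj.eq t ⟨ht.1, htb⟩]
    refine (hj.sol.ratio_le (hm.mono fun u hu => hu.1) hk hγ hh hj.mem.2 hj.pos_nonneg
      ⟨ht.1, htb⟩).trans_eq (congrArg (1 + ·) (lintegral_congr_ae ?_))
    filter_upwards [hm] with u hu
    rcases le_or_gt u t with hut | hut
    · simp only [hj.eq u ⟨hu.1, hut.trans htb⟩]
    · simp only [kernel_of_lt hut, zero_mul]
  · rw [hj.after t ⟨htb, ht.2⟩, zero_div, ENNReal.ofReal_zero]
    exact zero_le

lemma StoppedAt.exists_ratio_le (hj : StoppedAt m k s j b g) (hh : IsLive m γ s h) :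
    ∃ C, ∀ t ∈ Ioc 0 s, j t / pos m h t ≤ C := by
  obtain ⟨c, hc, hle⟩ := exists_mul_le_pos hh.integrable (hj.mem.1.le.trans hj.mem.2) hh.pos_pos
  have : 0 ≤ 1 + ∫ u, |g u| ∂m := by positivity
  refine ⟨(1 + ∫ u, |g u| ∂m) / c, fun t ht => ?_⟩
  rcases le_or_gt t b with htb | htb
  · rw [hj.eq t ⟨ht.1, htb⟩, div_le_div_iff₀ (hh.pos_pos t ht) hc]
    calc pos m g t * c ≤ (1 + ∫ u, |g u| ∂m) * t * c := by
          gcongr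
          exact (le_abs_self _).trans (abs_pos_le hj.sol.integrable ht.1.le)
      _ = (1 + ∫ u, |g u| ∂m) * (c * t) := by ring
      _ ≤ _ := by gcongr; exact hle t ht
  · rw [hj.after t ⟨htb, ht.2⟩, zero_div]
    positivity

lemma StoppedAt.le_tsum_neumann (hm : ∀ᵐ u ∂m, u ∈ Ioc 0 s) (hk : Measurable k)
    (hγ : Measurable γ) (hj : StoppedAt m k s j b g) (hh : IsLive m γ s h) :
    ENNReal.ofReal (j s / pos m h s) ≤
      ∑' n, neumann m (kernel (pos m h)) (fun u => k u - γ u) n s := by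
  obtain ⟨C, hC⟩ := hj.exists_ratio_le hh
  exact JacobiShuffle.le_tsum_neumann hm (z := fun t => ENNReal.ofReal (j t / pos m h t))
    (C := ENNReal.ofReal C) ENNReal.ofReal_ne_top
    (fun n t => aemeasurable_neumann_integrand hh.integrable (hk.sub hγ) n t)
    (fun t ht => hj.ratio_le hm hk hγ hh ht) (fun t ht => ENNReal.ofReal_le_ofReal (hC t ht))
    ⟨hj.mem.1.trans_le hj.mem.2, le_rfl⟩

lemma IsLive.tsum_neumann_le (hm : ∀ᵐ u ∂m, u ∈ Ioc 0 s) (hs : 0 < s) {k' : ℝ → ℝ}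
    (hk : Measurable k) (hk' : Measurable k') (hγ : Measurable γ) (hg : IsLive m k s g)
    (hh : IsLive m γ s h) (hle : ∀ᵐ u ∂m, γ u ≤ k u) (hle' : ∀ᵐ u ∂m, k' u ≤ k u) :
    ∑' n, neumann m (kernel (pos m h)) (fun u => k' u - γ u) n s ≤
      ENNReal.ofReal (pos m g s / pos m h s) := by
  refine JacobiShuffle.tsum_neumann_le hm
    (z := fun t => ENNReal.ofReal (pos m g t / pos m h t))
    (fun n t => aemeasurable_neumann_integrand hh.integrable (hk'.sub hγ) n t) ?_ ⟨hs, le_rfl⟩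
  intro t ht
  rw [hg.ratio_eq (hm.mono fun u hu => hu.1) hk hγ hh le_rfl (fun u hu => (hg.pos_pos u hu).le)
    (hle.mono fun u hu _ => hu) ht]
  gcongr 1 + ?_
  refine lintegral_mono_ae ?_
  filter_upwards [hle'] with u hu
  gcongr
  exact sub_le_sub_right hu _

lemma IsStopped.nonneg (hj : IsStopped m k s j) : 0 ≤ j s := by
  obtain ⟨b, g, hg⟩ := hj
  exact hg.nonneg ⟨hg.mem.1.trans_le hg.mem.2, le_rfl⟩

lemma IsStopped.le_of_ae_le {k' j' : ℝ → ℝ} (hm : ∀ᵐ u ∂m, u ∈ Ioc 0 s) (hk : Measurable k)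
    (hk' : Measurable k') (hj : IsStopped m k s j) (hj' : IsStopped m k' s j')
    (hle : ∀ᵐ u ∂m, k u ≤ k' u) : j s ≤ j' s := by
  rcases hj.nonneg.eq_or_lt with hzero | hpos
  · exact hzero.symm.le.trans hj'.nonneg
  obtain ⟨b, g, hg⟩ := id hj'
  have hs : 0 < s := hg.mem.1.trans_le hg.mem.2
  obtain ⟨h, hh, heq⟩ := hj.exists_isLive hpos
  obtain ⟨h', hh', heq'⟩ := hj'.exists_isLive (hg.pos_of_isLive hm hk' hk hh hle)
  rw [heq, heq']
  exact hh'.pos_le_pos (hm.mono fun u hu => hu.1) hk' hk hh le_rfl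
    (fun u hu => (hh'.pos_pos u hu).le) (hle.mono fun u hu _ => hu) ⟨hs, le_rfl⟩

lemma ofReal_rpow_mul_ofReal_div_rpow {x y p : ℝ} (hx : 0 ≤ x) (hy : 0 < y) (hp : 0 ≤ p) :
    ENNReal.ofReal (y ^ p) * ENNReal.ofReal (x / y) ^ p = ENNReal.ofReal (x ^ p) := by
  rw [ENNReal.ofReal_rpow_of_nonneg (by positivity) hp, ← ENNReal.ofReal_mul (by positivity),
    ← Real.mul_rpow hy.le (by positivity), mul_div_cancel₀ _ hy.ne']

lemma IsStopped.ofReal_rpow_le (hm : ∀ᵐ u ∂m, u ∈ Ioc 0 s) (hk : Measurable k)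
    (hγ : Measurable γ) (hj : IsStopped m k s j) (hh : IsLive m γ s h) {p : ℝ} (hp : 0 ≤ p) :
    ENNReal.ofReal (j s ^ p) ≤ ENNReal.ofReal (pos m h s ^ p) *
      (∑' n, neumann m (kernel (pos m h)) (fun u => k u - γ u) n s) ^ p := by
  obtain ⟨b, g, hg⟩ := id hj
  rw [← ofReal_rpow_mul_ofReal_div_rpow hj.nonneg
    (hh.pos_pos s ⟨hg.mem.1.trans_le hg.mem.2, le_rfl⟩) hp]
  gcongr
  exact hg.le_tsum_neumann hm hk hγ hh

lemma IsStopped.mul_tsum_neumann_rpow_le {k' : ℝ → ℝ} (hm : ∀ᵐ u ∂m, u ∈ Ioc 0 s) (hs : 0 < s)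
    (hk : Measurable k) (hk' : Measurable k') (hγ : Measurable γ) (hj : IsStopped m k s j)
    (hpos : 0 < j s) (hh : IsLive m γ s h) (hle : ∀ᵐ u ∂m, γ u ≤ k u)
    (hle' : ∀ᵐ u ∂m, k' u ≤ k u) {p : ℝ} (hp : 0 ≤ p) :
    ENNReal.ofReal (pos m h s ^ p) *
        (∑' n, neumann m (kernel (pos m h)) (fun u => k' u - γ u) n s) ^ p ≤
      ENNReal.ofReal (j s ^ p) := by
  obtain ⟨g, hg, heq⟩ := hj.exists_isLive hpos
  rw [← ofReal_rpow_mul_ofReal_div_rpow hpos.le (hh.pos_pos s ⟨hs, le_rfl⟩) hp, heq]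
  gcongr
  exact hg.tsum_neumann_le hm hs hk hk' hγ hh hle hle'

end Stopped

section Reduction

variable {m : Measure ℝ} [SFinite m] {g p : ℝ → ℝ} {b s : ℝ}

lemma intervalIntegrable_inv_sq (hg : Integrable g m) {a t : ℝ} (hat : a ≤ t)
    (h : ∀ r ∈ Icc a t, pos m g r ≠ 0) :
    IntervalIntegrable (fun r => (pos m g r ^ 2)⁻¹) volume a t := by
  refine ContinuousOn.intervalIntegrable ?_
  rw [uIcc_of_le hat]
  exact ((continuous_pos hg).pow 2).continuousOn.inv₀ fun r hr => pow_ne_zero 2 (h r hr)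

lemma integral_vel_div_sq (hg : Integrable g m) {a t : ℝ} (hat : a ≤ t)
    (h : ∀ r ∈ Icc a t, pos m g r ≠ 0) :
    ∫ r in a..t, vel m g r * (pos m g r ^ 2)⁻¹ = (pos m g a)⁻¹ - (pos m g t)⁻¹ := by
  have hint : IntervalIntegrable (fun r => vel m g r * (pos m g r ^ 2)⁻¹) volume a t := by
    refine (intervalIntegrable_vel hg a t).mul_continuousOn ?_
    rw [uIcc_of_le hat]
    exact ((continuous_pos hg).pow 2).continuousOn.inv₀ fun r hr => pow_ne_zero 2 (h r hr)
  rw [intervalIntegral.integral_eq_sub_of_hasDeriv_right_of_le hat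
    (f := fun r => -(pos m g r)⁻¹) ((continuous_pos hg).continuousOn.inv₀ h).neg
    (fun r hr => ?_) hint]
  · ring
  · exact ((hasDerivWithinAt_pos hg r).inv (h r (Ioo_subset_Icc_self hr))).neg.congr_deriv (by ring)

/-- Reduction of order: the multiple of the motion `pos m g` which, where `g = k · pos m g`, solves
the same Jacobi equation, with the position and velocity of `pos m p` at time `b`. -/
def continuation (m : Measure ℝ) (g p : ℝ → ℝ) (b t : ℝ) : ℝ :=
  pos m p b / pos m g b + wronskian m p g b * ∫ r in b..t, (pos m g r ^ 2)⁻¹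

lemma continuousOn_continuation (hg : Integrable g m) (hbs : b ≤ s)
    (h : ∀ r ∈ Icc b s, pos m g r ≠ 0) : ContinuousOn (continuation m g p b) (Icc b s) := by
  have := intervalIntegral.continuousOn_primitive_interval' (intervalIntegrable_inv_sq hg hbs h)
    left_mem_uIcc
  rw [uIcc_of_le hbs] at this
  exact continuousOn_const.add (continuousOn_const.mul this)

lemma vel_mul_continuation (hg : Integrable g m) (hb : 0 ≤ b) (h : ∀ r ∈ Icc b s, pos m g r ≠ 0)
    {t : ℝ} (ht : t ∈ Icc b s) :
    vel m g t * continuation m g p b t + wronskian m p g b / pos m g t =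
      vel m p b + ∫ u in Ioc b t, g u * continuation m g p b u ∂m := by
  have h' : ∀ r ∈ Icc b t, pos m g r ≠ 0 := fun r hr => h r ⟨hr.1, hr.2.trans ht.2⟩
  have hφ := (intervalIntegrable_inv_sq hg ht.1 h').const_mul (wronskian m p g b)
  have hmul := vel_mul_eq hg hb ht.1 (Z := continuation m g p b) hφ.1
    (fun u hu => by simp [continuation, intervalIntegral.integral_of_le hu.1, integral_const_mul])
    (integrableOn_mul_continuousOn hg (continuousOn_continuation hg ht.1 h'))
  have hvel := integral_vel_div_sq hg ht.1 h'
  rw [← intervalIntegral.integral_of_le (μ := volume) ht.1] at hmul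
  simp only [mul_left_comm (vel m g _), intervalIntegral.integral_const_mul, hvel] at hmul
  rw [hmul, continuation, intervalIntegral.integral_same, mul_zero, add_zero]
  have hgb := h b ⟨le_rfl, ht.1.trans ht.2⟩
  simp only [wronskian]
  field_simp
  ring

lemma hasDerivWithinAt_continuation (hg : Integrable g m) (h : ∀ r ∈ Icc b s, pos m g r ≠ 0)
    {t : ℝ} (ht : t ∈ Ico b s) :
    HasDerivWithinAt (fun t => pos m g t * continuation m g p b t)
      (vel m g t * continuation m g p b t + wronskian m p g b / pos m g t) (Ici t) t := by
  have hgt := h t ⟨ht.1, ht.2.le⟩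
  have hint := intervalIntegral.integral_hasDerivAt_right (a := b) (b := t)
    (f := fun r => (pos m g r ^ 2)⁻¹)
    (intervalIntegrable_inv_sq hg ht.1 fun r hr => h r ⟨hr.1, hr.2.trans ht.2.le⟩)
    ((continuous_pos hg).pow 2).measurable.inv.stronglyMeasurable.stronglyMeasurableAtFilter
    (((continuous_pos hg).pow 2).continuousAt.inv₀ (pow_ne_zero 2 hgt))
  refine ((hasDerivWithinAt_pos hg t).Ici_of_Ioi.mul
    ((hint.const_mul (wronskian m p g b)).const_add _).hasDerivWithinAt).congr_deriv ?_
  simp only [continuation]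
  field_simp

lemma pos_eq_mul_continuation (hg : Integrable g m) (hb : 0 ≤ b)
    (h : ∀ r ∈ Icc b s, pos m g r ≠ 0) {p' : ℝ → ℝ} (hp' : Integrable p' m)
    (hbefore : ∀ u ∈ Ioc 0 b, p' u = p u)
    (hafter : ∀ u ∈ Ioc b s, p' u = g u * continuation m g p b u) {t : ℝ} (ht : t ∈ Icc b s) :
    pos m p' t = pos m g t * continuation m g p b t := by
  have hpos : pos m p' b = pos m p b := pos_congr hb hbefore
  have hvel : ∀ t ∈ Icc b s,
      vel m p' t = vel m g t * continuation m g p b t + wronskian m p g b / pos m g t := by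
    intro t ht
    rw [vel_mul_continuation hg hb h ht, vel_eq_add_setIntegral hp' hb ht.1, vel_congr hbefore]
    congr 1
    exact setIntegral_congr_fun measurableSet_Ioc fun u hu => hafter u ⟨hu.1, hu.2.trans ht.2⟩
  refine eq_of_has_deriv_right_eq (fun t ht => ?_)
    (fun t ht => hasDerivWithinAt_continuation hg h ht) (continuous_pos hp').continuousOn
    ((continuous_pos hg).continuousOn.mul
      (continuousOn_continuation hg (ht.1.trans ht.2) h)) ?_ t ht
  · rw [← hvel t ⟨ht.1, ht.2.le⟩]
    exact (hasDerivWithinAt_pos hp' t).Ici_of_Ioi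
  · rw [hpos, continuation, intervalIntegral.integral_same, mul_zero, add_zero,
      mul_div_cancel₀ _ (h b ⟨le_rfl, ht.1.trans ht.2⟩)]

end Reduction

section Interpolation

variable {m : Measure ℝ} {g₁ g₂ : ℝ → ℝ} {b s θ : ℝ}

lemma vel_convexComb (h₁ : Integrable g₁ m) (h₂ : Integrable g₂ m) (t : ℝ) :
    vel m (fun u => θ * g₂ u + (1 - θ) * g₁ u) t = θ * vel m g₂ t + (1 - θ) * vel m g₁ t := by
  simp only [vel, integral_add (h₂.restrict.const_mul θ) (h₁.restrict.const_mul (1 - θ)),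
    integral_const_mul]
  ring

variable [SFinite m]

lemma pos_convexComb (h₁ : Integrable g₁ m) (h₂ : Integrable g₂ m) (t : ℝ) :
    pos m (fun u => θ * g₂ u + (1 - θ) * g₁ u) t = θ * pos m g₂ t + (1 - θ) * pos m g₁ t := by
  simp only [pos, vel_convexComb h₁ h₂]
  rw [intervalIntegral.integral_add ((intervalIntegrable_vel h₂ 0 t).const_mul θ)
    ((intervalIntegrable_vel h₁ 0 t).const_mul (1 - θ)), intervalIntegral.integral_const_mul,
    intervalIntegral.integral_const_mul]

lemma continuation_convexComb (h₁ : Integrable g₁ m) (h₂ : Integrable g₂ m)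
    (hb : pos m g₂ b ≠ 0) (t : ℝ) :
    continuation m g₂ (fun u => θ * g₂ u + (1 - θ) * g₁ u) b t =
      θ + (1 - θ) * continuation m g₂ g₁ b t := by
  simp only [continuation, wronskian, vel_convexComb h₁ h₂, pos_convexComb h₁ h₂]
  field_simp
  ring

variable {k₁ k₂ j : ℝ → ℝ}

lemma StoppedAt.wronskian_nonpos (h₁ : StoppedAt m k₁ s j b g₁) (h₂ : IsLive m k₂ s g₂)
    (hle : ∀ᵐ u ∂m, k₁ u ≤ k₂ u) : wronskian m g₁ g₂ b ≤ 0 := by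
  rw [wronskian_eq_setIntegral h₁.sol.integrable h₂.integrable h₁.mem.1.le]
  refine setIntegral_nonpos_of_ae_restrict ?_
  filter_upwards [ae_restrict_of_ae hle, ae_restrict_mem measurableSet_Ioc] with u hu hub
  have hus : u ∈ Ioc 0 s := ⟨hub.1, hub.2.trans h₁.mem.2⟩
  rw [h₁.sol.eq u hub, h₂.eq u hus]
  have := mul_nonneg (mul_nonneg (sub_nonneg.2 hu) (h₁.pos_nonneg u hub)) (h₂.pos_pos u hus).le
  simp only [Pi.zero_apply]
  linarith

lemma StoppedAt.continuation_antitoneOn (h₁ : StoppedAt m k₁ s j b g₁) (h₂ : IsLive m k₂ s g₂)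
    (hle : ∀ᵐ u ∂m, k₁ u ≤ k₂ u) : AntitoneOn (continuation m g₂ g₁ b) (Icc b s) := by
  intro t ht t' ht' htt'
  have hint : IntervalIntegrable (fun r => (pos m g₂ r ^ 2)⁻¹) volume b t' :=
    intervalIntegrable_inv_sq h₂.integrable ht'.1 fun r hr =>
      (h₂.pos_pos r ⟨h₁.mem.1.trans_le hr.1, hr.2.trans ht'.2⟩).ne'
  have hmono := intervalIntegral.integral_mono_interval le_rfl ht.1 htt'
    (.of_forall fun r => inv_nonneg.2 (sq_nonneg (pos m g₂ r))) hint
  exact add_le_add_right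
    (mul_le_mul_of_nonpos_left hmono (h₁.wronskian_nonpos h₂ hle)) _

lemma IsLive.exists_continuation {k κ g p : ℝ → ℝ} (hg : IsLive m k s g) (hp : IsLive m κ b p)
    (hb : b ∈ Ioc 0 s) (hcont : ∀ t ∈ Icc b s, 0 < continuation m g p b t) :
    ∃ h, IsLive m (fun u => if u ≤ b then κ u else k u) s h ∧
      ∀ t ∈ Icc b s, pos m h t = pos m g t * continuation m g p b t := by
  have hne : ∀ r ∈ Icc b s, pos m g r ≠ 0 := fun r hr =>
    (hg.pos_pos r ⟨hb.1.trans_le hr.1, hr.2⟩).ne'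
  set h : ℝ → ℝ := fun u => (Ioc 0 b).indicator p u +
    (Ioc b s).indicator (fun u => g u * continuation m g p b u) u
  have hint : Integrable h m := (hp.integrable.indicator measurableSet_Ioc).add
    ((integrable_indicator_iff measurableSet_Ioc).2 (integrableOn_mul_continuousOn hg.integrable
      (continuousOn_continuation hg.integrable hb.2 hne)))
  have hbefore : ∀ u ∈ Ioc 0 b, h u = p u := fun u hu => by simp [h, hu.1, hu.2, hu.2.not_gt]
  have hafter : ∀ u ∈ Ioc b s, h u = g u * continuation m g p b u := fun u hu => by
    simp [h, hu.1, hu.2, hu.1.not_ge]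
  have hpos : ∀ t ∈ Icc b s, pos m h t = pos m g t * continuation m g p b t := fun t ht =>
    pos_eq_mul_continuation hg.integrable hb.1.le hne hint hbefore hafter ht
  have hpos' : ∀ t ∈ Ioc 0 b, pos m h t = pos m p t := fun t ht =>
    pos_congr ht.1.le fun u hu => hbefore u ⟨hu.1, hu.2.trans ht.2⟩
  refine ⟨h, ⟨⟨hint, fun u hu => ?_⟩, fun u hu => ?_⟩, hpos⟩ <;> rcases le_or_gt u b with hub | hub
  · simp only [hub, if_true]
    rw [hbefore u ⟨hu.1, hub⟩, hpos' u ⟨hu.1, hub⟩, hp.eq u ⟨hu.1, hub⟩]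
  · simp only [hub.not_ge, if_false]
    rw [hafter u ⟨hub, hu.2⟩, hpos u ⟨hub.le, hu.2⟩, hg.eq u hu, mul_assoc]
  · rw [hpos' u ⟨hu.1, hub⟩]
    exact hp.pos_pos u ⟨hu.1, hub⟩
  · rw [hpos u ⟨hub.le, hu.2⟩]
    exact mul_pos (hg.pos_pos u hu) (hcont u ⟨hub.le, hu.2⟩)

/-- The coefficient of the Jacobi equation solved by `θ • p₂ + (1 - θ) • p₁`, where `p₁` and `p₂`
solve the equations with coefficients `k₁` and `k₂`. -/
def mixedCoeff (θ : ℝ) (k₁ p₁ k₂ p₂ : ℝ → ℝ) (u : ℝ) : ℝ :=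
  (θ * (k₂ u * p₂ u) + (1 - θ) * (k₁ u * p₁ u)) / (θ * p₂ u + (1 - θ) * p₁ u)

lemma mixedCoeff_mem_Icc {p₁ p₂ : ℝ → ℝ} {u : ℝ} (hθ : θ ∈ Ioc 0 1) (h₁ : 0 ≤ p₁ u)
    (h₂ : 0 < p₂ u) (hle : k₁ u ≤ k₂ u) :
    mixedCoeff θ k₁ p₁ k₂ p₂ u ∈ Icc (k₁ u) (k₂ u) := by
  have hw₂ : 0 < θ * p₂ u := mul_pos hθ.1 h₂
  have hw₁ : 0 ≤ (1 - θ) * p₁ u := mul_nonneg (sub_nonneg.2 hθ.2) h₁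
  rw [mixedCoeff, mem_Icc, le_div_iff₀ (by positivity), div_le_iff₀ (by positivity)]
  constructor
  · linarith [mul_le_mul_of_nonneg_right hle hw₂.le]
  · linarith [mul_le_mul_of_nonneg_right hle hw₁]

lemma StoppedAt.isLive_convexComb (h₁ : StoppedAt m k₁ s j b g₁) (h₂ : IsLive m k₂ s g₂)
    (hθ : θ ∈ Ioc 0 1) : IsLive m (mixedCoeff θ k₁ (pos m g₁) k₂ (pos m g₂)) b
      fun u => θ * g₂ u + (1 - θ) * g₁ u := by
  have hs : ∀ u ∈ Ioc 0 b, u ∈ Ioc 0 s := fun u hu => ⟨hu.1, hu.2.trans h₁.mem.2⟩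
  have hpos : ∀ u ∈ Ioc 0 b, 0 < θ * pos m g₂ u + (1 - θ) * pos m g₁ u := fun u hu =>
    add_pos_of_pos_of_nonneg (mul_pos hθ.1 (h₂.pos_pos u (hs u hu)))
      (mul_nonneg (sub_nonneg.2 hθ.2) (h₁.pos_nonneg u hu))
  refine ⟨⟨(h₂.integrable.const_mul θ).add (h₁.sol.integrable.const_mul (1 - θ)),
    fun u hu => ?_⟩, fun u hu => ?_⟩
  · rw [pos_convexComb h₁.sol.integrable h₂.integrable, mixedCoeff,
      div_mul_cancel₀ _ (hpos u hu).ne', h₁.sol.eq u hu, h₂.eq u (hs u hu)]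
  · rw [pos_convexComb h₁.sol.integrable h₂.integrable]
    exact hpos u hu

-- Mix the dead and the live solution until the dead one vanishes, then continue with `k₂`.
-- Relative to the live solution, the result decreases to a value at `s` which depends affinely on
-- the weight.
lemma StoppedAt.exists_between (hm : ∀ᵐ u ∂m, u ∈ Ioc 0 s) (hk₁ : Measurable k₁)
    (hk₂ : Measurable k₂) (h₁ : StoppedAt m k₁ s j b g₁) (hdead : j s = 0) (h₂ : IsLive m k₂ s g₂)
    (hle : ∀ᵐ u ∂m, k₁ u ≤ k₂ u) {ε : ℝ} (hε : ε ∈ Ioc 0 1) :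
    ∃ γ h, Measurable γ ∧ IsLive m γ s h ∧ (∀ᵐ u ∂m, k₁ u ≤ γ u) ∧ (∀ᵐ u ∂m, γ u ≤ k₂ u) ∧
      pos m h s = ε * pos m g₂ s := by
  have hanti := h₁.continuation_antitoneOn h₂ hle
  have hb : b ∈ Icc b s := ⟨le_rfl, h₁.mem.2⟩
  have hs : s ∈ Icc b s := ⟨h₁.mem.2, le_rfl⟩
  set w := continuation m g₂ g₁ b s
  have hw0 : w ≤ 0 := (hanti hb hs h₁.mem.2).trans_eq
    (by simp [continuation, h₁.pos_end_eq_zero hdead])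
  set θ := (ε - w) / (1 - w) with hθdef
  have hθ : θ ∈ Ioc 0 1 :=
    ⟨div_pos (by linarith [hε.1]) (by linarith), (div_le_one (by linarith)).2 (by linarith [hε.2])⟩
  have hεθ : θ + (1 - θ) * w = ε := by
    have : 1 - w ≠ 0 := by linarith
    rw [hθdef]
    field_simp
    ring
  have hcont := continuation_convexComb (θ := θ) h₁.sol.integrable h₂.integrable
    (h₂.pos_pos b h₁.mem).ne'
  obtain ⟨h, hh, hpos⟩ := h₂.exists_continuation (h₁.isLive_convexComb h₂ hθ) h₁.mem fun t ht => by
    have := mul_le_mul_of_nonneg_left (hanti ht hs ht.2) (sub_nonneg.2 hθ.2)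
    linarith [hcont t, hε.1]
  have hmem : ∀ᵐ u ∂m, (if u ≤ b then mixedCoeff θ k₁ (pos m g₁) k₂ (pos m g₂) u else k₂ u) ∈
      Icc (k₁ u) (k₂ u) := by
    filter_upwards [hm, hle] with u hu huk
    split_ifs with hub
    · exact mixedCoeff_mem_Icc hθ (h₁.pos_nonneg u ⟨hu.1, hub⟩) (h₂.pos_pos u hu) huk
    · exact ⟨huk, le_rfl⟩
  refine ⟨_, h, Measurable.ite measurableSet_Iic ?_ hk₂, hh, hmem.mono fun u hu => hu.1,
    hmem.mono fun u hu => hu.2, ?_⟩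
  · have hp₁ := (continuous_pos h₁.sol.integrable).measurable
    have hp₂ := (continuous_pos h₂.integrable).measurable
    unfold mixedCoeff
    fun_prop
  · rw [hpos s hs, hcont, hεθ, mul_comm]

end Interpolation

section Extinction

lemma lintegral_Ici_inv_sq {u : ℝ} (hu : 0 < u) :
    ∫⁻ r in Ici u, ENNReal.ofReal (r ^ 2)⁻¹ = ENNReal.ofReal u⁻¹ := by
  have hrpow : ∀ r ∈ Ioi u, r ^ (-2 : ℝ) = (r ^ 2)⁻¹ := fun r hr => by
    rw [Real.rpow_neg (hu.trans hr).le, Real.rpow_two]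
  have hint : IntegrableOn (fun r : ℝ => (r ^ 2)⁻¹) (Ioi u) :=
    (integrableOn_Ioi_rpow_of_lt (by norm_num : (-2 : ℝ) < -1) hu).congr_fun hrpow measurableSet_Ioi
  rw [setLIntegral_congr Ioi_ae_eq_Ici.symm, ← ofReal_integral_eq_lintegral_ofReal hint
    (.of_forall fun r => by positivity), ← setIntegral_congr_fun measurableSet_Ioi hrpow,
    integral_Ioi_rpow_of_lt (by norm_num) hu]
  norm_num [Real.rpow_neg_one]

lemma kernel_le_of_linear {p : ℝ → ℝ} {c C t u : ℝ} (hc : 0 < c) (hu : 0 < u)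
    (hupper : |p u| ≤ C * u) (hlower : ∀ r ∈ Icc u t, c * r ≤ p r) :
    kernel p t u ≤ ENNReal.ofReal ((C / c) ^ 2) * ENNReal.ofReal u := by
  have hle : ∀ r ∈ Icc u t, p u ^ 2 / p r ^ 2 ≤ (C * u) ^ 2 / c ^ 2 * (r ^ 2)⁻¹ := by
    intro r hr
    have hr0 : 0 < c * r := mul_pos hc (hu.trans_le hr.1)
    calc p u ^ 2 / p r ^ 2 ≤ (C * u) ^ 2 / (c * r) ^ 2 := by
          rw [← sq_abs (p u)]
          gcongr
          exact hlower r hr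
      _ = _ := by rw [mul_pow c, div_mul_eq_div_div, div_eq_mul_inv _ (r ^ 2)]
  calc kernel p t u
      ≤ ∫⁻ r in Icc u t, ENNReal.ofReal ((C * u) ^ 2 / c ^ 2 * (r ^ 2)⁻¹) :=
        setLIntegral_mono (by fun_prop) fun r hr => ENNReal.ofReal_le_ofReal (hle r hr)
    _ ≤ ∫⁻ r in Ici u, ENNReal.ofReal ((C * u) ^ 2 / c ^ 2 * (r ^ 2)⁻¹) :=
        lintegral_mono_set Icc_subset_Ici_self
    _ = ENNReal.ofReal ((C * u) ^ 2 / c ^ 2) * ENNReal.ofReal u⁻¹ := by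
        simp_rw [ENNReal.ofReal_mul (show 0 ≤ (C * u) ^ 2 / c ^ 2 by positivity)]
        rw [lintegral_const_mul _ (by fun_prop), lintegral_Ici_inv_sq hu]
    _ = _ := by
        rw [← ENNReal.ofReal_mul (by positivity), ← ENNReal.ofReal_mul (by positivity)]
        congr 1
        field_simp

variable {m : Measure ℝ} [SFinite m] {k γ j g h : ℝ → ℝ} {s b : ℝ}

lemma IsLive.lintegral_mul_abs_ne_top (hs : 0 ≤ s) (hm : ∀ᵐ u ∂m, u ∈ Ioc 0 s)
    (hh : IsLive m γ s h) : ∫⁻ u, ENNReal.ofReal u * ENNReal.ofReal |γ u| ∂m ≠ ∞ := by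
  obtain ⟨c, hc, hle⟩ := exists_mul_le_pos hh.integrable hs hh.pos_pos
  have hfin : ∫⁻ u, ENNReal.ofReal (c⁻¹ * |h u|) ∂m ≠ ∞ :=
    (hh.integrable.abs.const_mul c⁻¹).lintegral_lt_top.ne
  refine ne_top_of_le_ne_top hfin (lintegral_mono_ae ?_)
  filter_upwards [hm] with u hu
  rw [← ENNReal.ofReal_mul hu.1.le]
  refine ENNReal.ofReal_le_ofReal ?_
  rw [hh.eq u hu, abs_mul, abs_of_pos (hh.pos_pos u hu), le_inv_mul_iff₀ hc]
  calc c * (u * |γ u|) = |γ u| * (c * u) := by ring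
    _ ≤ _ := by gcongr; exact hle u hu

lemma StoppedAt.ratio_le_mul_lintegral_kernel (hm : ∀ᵐ u ∂m, u ∈ Ioc 0 s) (hk : Measurable k)
    (hγ : Measurable γ) (hj : StoppedAt m k s j b g) (hdead : j s = 0) (hh : IsLive m γ s h)
    {M : ℝ≥0∞} (hM : ∀ t ∈ Ioc 0 b, ENNReal.ofReal (pos m g t / pos m h t) ≤ M) {t : ℝ}
    (ht : t ∈ Ioc 0 b) : ENNReal.ofReal (pos m g t / pos m h t) ≤
      M * ∫⁻ u, kernel (pos m h) s u * ENNReal.ofReal (γ u - k u) ∂m := by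
  have hm0 : ∀ᵐ u ∂m, 0 < u := hm.mono fun u hu => hu.1
  have hbalance {t} (ht : t ∈ Ioc 0 b) :=
    hj.sol.ratio_add_lintegral_kernel hm0 hk hγ hh hj.mem.2 hj.pos_nonneg ht
  have hend := hbalance ⟨hj.mem.1, le_rfl⟩
  rw [hj.pos_end_eq_zero hdead, zero_div, ENNReal.ofReal_zero, zero_add] at hend
  have hK := measurable_kernel (continuous_pos hh.integrable).measurable
  calc ENNReal.ofReal (pos m g t / pos m h t)
      ≤ 1 + ∫⁻ u, kernel (pos m h) t u * (ENNReal.ofReal (k u - γ u) *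
          ENNReal.ofReal (pos m g u / pos m h u)) ∂m := le_self_add.trans_eq (hbalance ht)
    _ ≤ 1 + ∫⁻ u, kernel (pos m h) b u * (ENNReal.ofReal (k u - γ u) *
          ENNReal.ofReal (pos m g u / pos m h u)) ∂m := by
        gcongr with u
        exact kernel_le_kernel ht.2 u
    _ = ∫⁻ u, kernel (pos m h) b u * (ENNReal.ofReal (γ u - k u) *
          ENNReal.ofReal (pos m g u / pos m h u)) ∂m := hend.symm
    _ ≤ ∫⁻ u, M * (kernel (pos m h) s u * ENNReal.ofReal (γ u - k u)) ∂m := by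
        refine lintegral_mono_ae ?_
        filter_upwards [hm] with u hu
        rcases le_or_gt u b with hub | hub
        · rw [← mul_assoc, mul_comm M]
          gcongr
          · exact kernel_le_kernel hj.mem.2 u
          · exact hM u ⟨hu.1, hub⟩
        · simp [kernel_of_lt hub]
    _ = _ := lintegral_const_mul _ ((hK.comp measurable_prodMk_left).mul (by fun_prop))

lemma StoppedAt.one_le_lintegral_kernel (hm : ∀ᵐ u ∂m, u ∈ Ioc 0 s) (hk : Measurable k)
    (hγ : Measurable γ) (hj : StoppedAt m k s j b g) (hdead : j s = 0) (hh : IsLive m γ s h) :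
    1 ≤ ∫⁻ u, kernel (pos m h) s u * ENNReal.ofReal (γ u - k u) ∂m := by
  set y : ℝ → ℝ≥0∞ := fun t => ENNReal.ofReal (pos m g t / pos m h t)
  set M := ⨆ t ∈ Ioc 0 b, y t
  have hM : ∀ t ∈ Ioc 0 b, y t ≤ M := fun t ht =>
    le_iSup₂ (f := fun t (_ : t ∈ Ioc 0 b) => y t) t ht
  obtain ⟨C, hC⟩ := hj.exists_ratio_le hh
  have hMtop : M ≠ ∞ := by
    refine ((iSup₂_le fun t ht => ?_).trans_lt (ENNReal.ofReal_lt_top (r := C))).ne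
    simp only [y, ← hj.eq t ht]
    exact ENNReal.ofReal_le_ofReal (hC t ⟨ht.1, ht.2.trans hj.mem.2⟩)
  have hM0 : M ≠ 0 := by
    have hb := hj.mem.1
    refine ((ENNReal.ofReal_pos.2 (div_pos (hj.pos_pos (b / 2) ⟨by linarith, by linarith⟩)
      (hh.pos_pos (b / 2) ⟨by linarith, by linarith [hj.mem.2]⟩))).trans_le
      (hM (b / 2) ⟨by linarith, by linarith⟩)).ne'
  have hle : M ≤ M * ∫⁻ u, kernel (pos m h) s u * ENNReal.ofReal (γ u - k u) ∂m :=
    iSup₂_le fun t ht => hj.ratio_le_mul_lintegral_kernel hm hk hγ hdead hh hM ht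
  exact (ENNReal.mul_le_mul_iff_right hM0 hMtop).1 ((mul_one M).trans_le hle)

lemma IsLive.tendsto_lintegral_kernel (hs : 0 ≤ s) (hm : ∀ᵐ u ∂m, u ∈ Ioc 0 s)
    (hk : Measurable k) (hh : IsLive m k s h) {κ : ℕ → ℝ → ℝ} (hκ : ∀ n, Measurable (κ n))
    (hmono : ∀ᵐ u ∂m, Monotone fun n => κ n u) (hcof : ∀ᵐ u ∂m, ∃ n, k u ≤ κ n u)
    (hneg : ∫⁻ u, ENNReal.ofReal u * ENNReal.ofReal (-κ 0 u) ∂m ≠ ∞) :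
    Tendsto (fun n => ∫⁻ u, kernel (pos m h) s u * ENNReal.ofReal (k u - κ n u) ∂m) atTop
      (𝓝 0) := by
  obtain ⟨c, hc, hle⟩ := exists_mul_le_pos hh.integrable hs hh.pos_pos
  have hK := (measurable_kernel (continuous_pos hh.integrable).measurable).comp
    (measurable_prodMk_left (x := s))
  set A := ENNReal.ofReal (((1 + ∫ u, |h u| ∂m) / c) ^ 2)
  have hlim : Tendsto (fun n => ∫⁻ u, kernel (pos m h) s u * ENNReal.ofReal (k u - κ n u) ∂m) atTop
      (𝓝 (∫⁻ _, 0 ∂m)) := by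
    refine tendsto_lintegral_of_dominated_convergence (fun u => A *
      (ENNReal.ofReal u * ENNReal.ofReal |k u| + ENNReal.ofReal u * ENNReal.ofReal (-κ 0 u)))
      (fun n => hK.mul (hk.sub (hκ n)).ennreal_ofReal) (fun n => ?_) ?_ ?_
    · filter_upwards [hm, hmono] with u hu hmonou
      rw [← mul_add, ← mul_assoc]
      refine mul_le_mul' (kernel_le_of_linear hc hu.1 (abs_pos_le hh.integrable hu.1.le)
        fun r hr => hle r ⟨hu.1.trans_le hr.1, hr.2⟩) ?_
      refine (ENNReal.ofReal_le_ofReal ?_).trans ENNReal.ofReal_add_le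
      linarith [le_abs_self (k u), hmonou (Nat.zero_le n)]
    · have hm0 : Measurable fun u => ENNReal.ofReal u * ENNReal.ofReal |k u| := by fun_prop
      rw [lintegral_const_mul' _ _ ENNReal.ofReal_ne_top, lintegral_add_left hm0]
      exact ENNReal.mul_ne_top ENNReal.ofReal_ne_top
        (ENNReal.add_ne_top.2 ⟨hh.lintegral_mul_abs_ne_top hs hm, hneg⟩)
    · filter_upwards [hmono, hcof] with u hmonou ⟨N, hN⟩
      refine tendsto_const_nhds.congr' ?_
      filter_upwards [eventually_ge_atTop N] with n hn
      rw [ENNReal.ofReal_of_nonpos (sub_nonpos.2 (hN.trans (hmonou hn))), mul_zero]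
  rwa [lintegral_zero] at hlim

lemma IsLive.exists_pos_of_eventually_le (hs : 0 < s) (hm : ∀ᵐ u ∂m, u ∈ Ioc 0 s)
    (hk : Measurable k) (hh : IsLive m k s h) {κ : ℕ → ℝ → ℝ} (hκ : ∀ n, Measurable (κ n))
    (hmono : ∀ᵐ u ∂m, Monotone fun n => κ n u) (hcof : ∀ᵐ u ∂m, ∃ n, k u ≤ κ n u)
    (hneg : ∫⁻ u, ENNReal.ofReal u * ENNReal.ofReal (-κ 0 u) ∂m ≠ ∞) {j : ℕ → ℝ → ℝ}
    (hj : ∀ n, IsStopped m (κ n) s (j n)) : ∃ n, 0 < j n s := by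
  by_contra! hnonpos
  refine (one_pos (α := ℝ≥0∞)).not_ge (ge_of_tendsto'
    (hh.tendsto_lintegral_kernel hs.le hm hk hκ hmono hcof hneg) fun n => ?_)
  obtain ⟨b, g, hg⟩ := hj n
  exact hg.one_le_lintegral_kernel hm (hκ n) hk
    ((hnonpos n).antisymm (hg.nonneg ⟨hs, le_rfl⟩)) hh

end Extinction

section Families

variable {T : Type*}

lemma tendsto_ofReal_one_div_mul_rpow (M : ℝ) {p : ℝ} (hp : 0 < p) :
    Tendsto (fun n : ℕ => ENNReal.ofReal ((1 / ((n : ℝ) + 1) * M) ^ p)) atTop (𝓝 0) := by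
  have hlim := ENNReal.tendsto_ofReal <|
    (tendsto_one_div_add_atTop_nhds_zero_nat.mul_const M).rpow_const (.inr hp.le)
  rwa [zero_mul, Real.zero_rpow hp.ne', ENNReal.ofReal_zero] at hlim

lemma exists_seq_coinitial {S : Set T} (hS : S.Nonempty) (r : T → ℝ) :
    ∃ θ : ℕ → T, (∀ n, θ n ∈ S) ∧ Antitone (fun n => r (θ n)) ∧ ∀ τ ∈ S, ∃ n, r (θ n) ≤ r τ := by
  -- Composing with `arctan` makes the ranks bounded below.
  set R : T → ℝ := fun τ => Real.arctan (r τ)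
  have hR : ∀ a b, R a ≤ R b ↔ r a ≤ r b := fun a b => Real.arctan_strictMono.le_iff_le
  have hglb : IsGLB (R '' S) (sInf (R '' S)) := isGLB_csInf (hS.image R)
    ⟨-(Real.pi / 2), by rintro _ ⟨τ, _, rfl⟩; exact (Real.neg_pi_div_two_lt_arctan _).le⟩
  by_cases hmin : sInf (R '' S) ∈ R '' S
  · obtain ⟨θ, hθ, hθmin⟩ := hmin
    refine ⟨fun _ => θ, fun _ => hθ, fun _ _ _ => le_rfl, fun τ hτ => ⟨0, (hR _ _).1 ?_⟩⟩
    rw [hθmin]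
    exact hglb.1 ⟨τ, hτ, rfl⟩
  · obtain ⟨u, hanti, -, hlim, hu⟩ :=
      hglb.exists_seq_strictAnti_tendsto_of_notMem hmin (hS.image R)
    choose θ hθ hθu using hu
    refine ⟨θ, hθ, fun a b hab => (hR _ _).1 ?_, fun τ hτ => ?_⟩
    · rw [hθu, hθu]
      exact hanti.antitone hab
    · have hlt : sInf (R '' S) < R τ :=
        lt_of_le_of_ne (hglb.1 ⟨τ, hτ, rfl⟩) fun h => hmin (h ▸ ⟨τ, hτ, rfl⟩)
      obtain ⟨n, hn⟩ := (hlim.eventually (gt_mem_nhds hlt)).exists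
      exact ⟨n, (hR _ _).1 (by rw [hθu]; exact hn.le)⟩

lemma exists_seq_cofinal {S : Set T} (hS : S.Nonempty) (r : T → ℝ) :
    ∃ η : ℕ → T, (∀ n, η n ∈ S) ∧ Monotone (fun n => r (η n)) ∧ ∀ τ ∈ S, ∃ n, r τ ≤ r (η n) := by
  obtain ⟨η, hη, hanti, hco⟩ := exists_seq_coinitial hS fun τ => -r τ
  refine ⟨η, hη, fun a b hab => neg_le_neg_iff.1 (hanti hab), fun τ hτ => ?_⟩
  obtain ⟨n, hn⟩ := hco τ hτ
  exact ⟨n, neg_le_neg_iff.1 hn⟩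

variable [MeasurableSpace T]

lemma tendsto_measure_zero_of_antitone {μ : Measure T} [IsFiniteMeasure μ] {E : ℕ → Set T}
    (hE : ∀ n, MeasurableSet (E n)) (hanti : Antitone E) (hae : ∀ᵐ τ ∂μ, ∃ n, τ ∉ E n) :
    Tendsto (fun n => μ (E n)) atTop (𝓝 0) := by
  have hlim := tendsto_measure_iInter_atTop (μ := μ) (fun n => (hE n).nullMeasurableSet) hanti
    ⟨0, measure_ne_top _ _⟩
  have hzero : μ (⋂ n, E n) = 0 := by
    rw [measure_eq_zero_iff_ae_notMem]
    filter_upwards [hae] with τ hτ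
    simpa only [mem_iInter, not_forall] using hτ
  rwa [hzero] at hlim

lemma ae_ae_mem_imp_le {α : Type*} [MeasurableSpace α] {μ : Measure T} {ν : Measure α} [SFinite μ]
    [SFinite ν] {f g : T → α → ℝ} (hf : Measurable fun x : T × α => f x.1 x.2)
    (hg : Measurable fun x : T × α => g x.1 x.2) {A : Set T} (hA : MeasurableSet A)
    (h : ∀ τ ∈ A, ∀ᵐ u ∂ν, f τ u ≤ g τ u) : ∀ᵐ u ∂ν, ∀ᵐ τ ∂μ, τ ∈ A → f τ u ≤ g τ u := by
  have hset : MeasurableSet {x : T × α | x.1 ∈ A → f x.1 x.2 ≤ g x.1 x.2} := by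
    simp only [imp_iff_not_or]
    exact (measurable_fst hA).compl.union (measurableSet_le hf hg)
  refine (Measure.ae_ae_comm hset).1 (.of_forall fun τ => ?_)
  by_cases hτ : τ ∈ A
  · exact (h τ hτ).mono fun u hu _ => hu
  · exact .of_forall fun u hmem => absurd hmem hτ

lemma tot_eq_zero {μ : Measure T} {j : T → ℝ → ℝ} {s p : ℝ} (hp : 0 < p)
    (hj : ∀ᵐ τ ∂μ, j τ s = 0) : Tot μ s p j = 0 := by
  refine lintegral_eq_zero_of_ae_eq_zero ?_
  filter_upwards [hj] with τ hτ
  simp [hτ, Real.zero_rpow hp.ne']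

/-- A measurable family of coefficients on `(0, s]` ordered by a real rank `r`, together with
shuffles `σ u` that preserve the measure on the index space. -/
structure RankedShuffle (μ : Measure T) (m : Measure ℝ) (s : ℝ) (r : T → ℝ) (k : T → ℝ → ℝ)
    (σ : ℝ → T → T) : Prop where
  s_pos : 0 < s
  mem : ∀ᵐ u ∂m, u ∈ Ioc 0 s
  measurable_rank : Measurable r
  measurable_coeff : Measurable fun x : T × ℝ => k x.1 x.2
  coeff_le : ∀ τ τ', r τ ≤ r τ' → ∀ᵐ u ∂m, k τ u ≤ k τ' u
  measurable_shuffle : Measurable fun x : T × ℝ => σ x.2 x.1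
  preserving : ∀ᵐ u ∂m, MeasurePreserving (σ u) μ μ

namespace RankedShuffle

variable {μ : Measure T} {m : Measure ℝ} {s : ℝ} {r : T → ℝ}
  {k : T → ℝ → ℝ} {σ : ℝ → T → T} {j₀ jσ : T → ℝ → ℝ}

lemma measurable_section (H : RankedShuffle μ m s r k σ) (τ : T) : Measurable (k τ) :=
  H.measurable_coeff.comp measurable_prodMk_left

lemma measurable_shuffled (H : RankedShuffle μ m s r k σ) :
    Measurable fun x : T × ℝ => k (σ x.2 x.1) x.2 :=
  H.measurable_coeff.comp (f := fun x : T × ℝ => (σ x.2 x.1, x.2))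
    (H.measurable_shuffle.prodMk measurable_snd)

lemma measurable_shuffled_section (H : RankedShuffle μ m s r k σ) (τ : T) :
    Measurable fun u => k (σ u τ) u :=
  H.measurable_shuffled.comp (measurable_prodMk_left (x := τ))

lemma measurable_neg_shuffled (H : RankedShuffle μ m s r k σ) :
    Measurable fun x : T × ℝ => ENNReal.ofReal x.2 * ENNReal.ofReal (-k (σ x.2 x.1) x.2) :=
  measurable_snd.ennreal_ofReal.mul H.measurable_shuffled.neg.ennreal_ofReal

lemma ae_monotone_coeff (H : RankedShuffle μ m s r k σ) {η : ℕ → T}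
    (hη : Monotone fun n => r (η n)) : ∀ᵐ u ∂m, Monotone fun n => k (η n) u := by
  filter_upwards [ae_all_iff.2 fun n => H.coeff_le _ _ (hη (Nat.le_succ n))] with u hu
  exact monotone_nat_of_le_succ hu

lemma exists_seq_cofinal_measure_lt [IsProbabilityMeasure μ] (H : RankedShuffle μ m s r k σ)
    {P : T → Prop} (hP : ∀ᵐ τ ∂μ, P τ) {δ : ℝ≥0∞} (hδ : 0 < δ) :
    ∃ η : ℕ → T, (∀ n, P (η n)) ∧ Monotone (fun n => r (η n)) ∧
      (∀ᵐ τ ∂μ, ∃ n, r τ ≤ r (η n)) ∧ μ {τ | r (η 0) < r τ} < δ := by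
  obtain ⟨η, hη, hmono, hco⟩ := exists_seq_cofinal (S := {τ | P τ}) hP.exists r
  have hlim : Tendsto (fun n => μ {τ | r (η n) < r τ}) atTop (𝓝 0) :=
    tendsto_measure_zero_of_antitone
      (fun n => measurableSet_lt measurable_const H.measurable_rank)
      (fun a b hab τ hτ => (hmono hab).trans_lt hτ)
      (hP.mono fun τ hτ => (hco τ hτ).imp fun n hn => hn.not_gt)
  obtain ⟨N, hN⟩ := (hlim.eventually (gt_mem_nhds hδ)).exists
  refine ⟨fun n => η (n + N), fun n => hη _, fun a b hab => hmono (Nat.add_le_add_right hab N),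
    ?_, by simpa only [zero_add] using hN⟩
  filter_upwards [hP] with τ hτ
  exact (hco τ hτ).imp fun n hn => hn.trans (hmono (Nat.le_add_right n N))

variable [SFinite m]

lemma ae_coeff_le_of_rank_le [SFinite μ] (H : RankedShuffle μ m s r k σ) :
    ∀ᵐ u ∂m, ∀ᵐ τ ∂μ, ∀ᵐ τ' ∂μ, r τ' ≤ r τ → k τ' u ≤ k τ u := by
  have hr := H.measurable_rank
  have hfst : Measurable fun z : (T × T) × ℝ => k z.1.1 z.2 :=
    H.measurable_coeff.comp (f := fun z : (T × T) × ℝ => (z.1.1, z.2)) (by fun_prop)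
  have hsnd : Measurable fun z : (T × T) × ℝ => k z.1.2 z.2 :=
    H.measurable_coeff.comp (f := fun z : (T × T) × ℝ => (z.1.2, z.2)) (by fun_prop)
  have hA : MeasurableSet {x : T × T | r x.2 ≤ r x.1} :=
    measurableSet_le (by fun_prop) (by fun_prop)
  filter_upwards [ae_ae_mem_imp_le (μ := μ.prod μ) (f := fun x u => k x.2 u)
    (g := fun x u => k x.1 u) hsnd hfst hA fun x hx => H.coeff_le _ _ hx] with u hu
  exact Measure.ae_ae_of_ae_prod hu

/-- A positive solution `h` on `(0, s]` relative to which the members of the family are compared: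
its coefficient `γ` lies above the members in `B` and below the member `θ`. -/
structure IsBase (m : Measure ℝ) (k : T → ℝ → ℝ) (s : ℝ) (B : Set T) (θ : T) (γ h : ℝ → ℝ) :
    Prop where
  measurable : Measurable γ
  isLive : IsLive m γ s h
  le_coeff : ∀ᵐ u ∂m, γ u ≤ k θ u
  coeff_le : ∀ τ ∈ B, ∀ᵐ u ∂m, k τ u ≤ γ u

section Comparison

variable {γ h : ℝ → ℝ} {θ : T} {B : Set T} {p : ℝ}

lemma mul_tsum_neumann_rpow_le_add (H : RankedShuffle μ m s r k σ) (hbase : IsBase m k s B θ γ h)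
    (hθ : IsStopped m (k θ) s (j₀ θ)) (hpos : 0 < j₀ θ s) (hp : 0 ≤ p) {τ : T}
    (hτ : IsStopped m (k τ) s (j₀ τ)) :
    ENNReal.ofReal (pos m h s ^ p) *
        (∑' n, neumann m (kernel (pos m h)) (fun u => k τ u - γ u) n s) ^ p ≤
      ENNReal.ofReal (j₀ τ s ^ p) + B.indicator (fun _ => ENNReal.ofReal (pos m h s ^ p)) τ +
        ({τ | r τ < r θ} \ B).indicator (fun _ => ENNReal.ofReal (j₀ θ s ^ p)) τ := by
  have hk := H.measurable_section
  obtain ⟨hγ, hh, hγθ, hBγ⟩ := hbase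
  by_cases hτB : τ ∈ B
  · rw [tsum_neumann_eq_one ((hBγ τ hτB).mono fun u hu => sub_nonpos.2 hu), ENNReal.one_rpow,
      mul_one, indicator_of_mem hτB]
    exact le_add_self.trans le_self_add
  rcases lt_or_ge (r τ) (r θ) with hlt | hge
  · rw [indicator_of_mem (show τ ∈ {τ | r τ < r θ} \ B from ⟨hlt, hτB⟩)]
    exact (hθ.mul_tsum_neumann_rpow_le H.mem H.s_pos (hk θ) (hk τ) hγ hpos hh hγθ
      (H.coeff_le _ _ hlt.le) hp).trans le_add_self
  · have hle := H.coeff_le _ _ hge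
    have hτpos : 0 < j₀ τ s := hpos.trans_le (hθ.le_of_ae_le H.mem (hk θ) (hk τ) hτ hle)
    refine (hτ.mul_tsum_neumann_rpow_le H.mem H.s_pos (hk τ) (hk τ) hγ hτpos hh ?_
      (.of_forall fun u => le_rfl) hp).trans (le_self_add.trans le_self_add)
    filter_upwards [hle, hγθ] with u h₁ h₂ using h₂.trans h₁

variable [IsProbabilityMeasure μ]

lemma tot_shuffled_le_lintegral_neumann (H : RankedShuffle μ m s r k σ)
    (hσ : ∀ᵐ τ ∂μ, IsStopped m (fun u => k (σ u τ) u) s (jσ τ)) (hγ : Measurable γ)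
    (hh : IsLive m γ s h) (hp : 1 ≤ p) :
    Tot μ s p jσ ≤ ∫⁻ τ, ENNReal.ofReal (pos m h s ^ p) *
      (∑' n, neumann m (kernel (pos m h)) (fun u => k τ u - γ u) n s) ^ p ∂μ := by
  have hq : Measurable fun x : T × ℝ => k x.1 x.2 - γ x.2 :=
    H.measurable_coeff.sub (hγ.comp measurable_snd)
  rw [lintegral_const_mul' _ _ ENNReal.ofReal_ne_top]
  calc Tot μ s p jσ
      ≤ ∫⁻ τ, ENNReal.ofReal (pos m h s ^ p) *
          (∑' n, neumann m (kernel (pos m h)) (fun u => k (σ u τ) u - γ u) n s) ^ p ∂μ :=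
        lintegral_mono_ae <| hσ.mono fun τ hτ =>
          hτ.ofReal_rpow_le H.mem (H.measurable_shuffled_section τ) hγ hh (by linarith)
    _ = ENNReal.ofReal (pos m h s ^ p) * ∫⁻ τ,
          (∑' n, neumann m (kernel (pos m h)) (fun u => k (σ u τ) u - γ u) n s) ^ p ∂μ :=
        lintegral_const_mul' _ _ ENNReal.ofReal_ne_top
    _ ≤ _ := by
        refine mul_le_mul_right (lintegral_neumann_rpow_le (r := r)
          (q := fun τ u => k τ u - γ u)
          (measurable_kernel (continuous_pos hh.integrable).measurable)
          H.measurable_rank hq ?_ H.measurable_shuffle H.preserving s hp) _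
        filter_upwards [H.ae_coeff_le_of_rank_le] with u hu
        filter_upwards [hu] with τ hτ
        exact hτ.mono fun τ' hτ' hle => sub_le_sub_right (hτ' hle) _

lemma tot_le_add (H : RankedShuffle μ m s r k σ) (h₀ : ∀ᵐ τ ∂μ, IsStopped m (k τ) s (j₀ τ))
    (hσ : ∀ᵐ τ ∂μ, IsStopped m (fun u => k (σ u τ) u) s (jσ τ)) (hB : MeasurableSet B)
    (hbase : IsBase m k s B θ γ h) (hθ : IsStopped m (k θ) s (j₀ θ)) (hpos : 0 < j₀ θ s)
    (hp : 1 ≤ p) :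
    Tot μ s p jσ ≤ Tot μ s p j₀ + ENNReal.ofReal (pos m h s ^ p) * μ B +
      ENNReal.ofReal (j₀ θ s ^ p) * μ ({τ | r τ < r θ} \ B) := by
  have hE : MeasurableSet ({τ | r τ < r θ} \ B) :=
    (measurableSet_lt H.measurable_rank measurable_const).diff hB
  calc Tot μ s p jσ
      ≤ ∫⁻ τ, ENNReal.ofReal (pos m h s ^ p) *
          (∑' n, neumann m (kernel (pos m h)) (fun u => k τ u - γ u) n s) ^ p ∂μ :=
        H.tot_shuffled_le_lintegral_neumann hσ hbase.measurable hbase.isLive hp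
    _ ≤ ∫⁻ τ, (ENNReal.ofReal (j₀ τ s ^ p) +
          B.indicator (fun _ => ENNReal.ofReal (pos m h s ^ p)) τ +
          ({τ | r τ < r θ} \ B).indicator (fun _ => ENNReal.ofReal (j₀ θ s ^ p)) τ) ∂μ :=
        lintegral_mono_ae <| h₀.mono fun τ hτ =>
          H.mul_tsum_neumann_rpow_le_add hbase hθ hpos (by linarith) hτ
    _ = _ := by
        rw [lintegral_add_right _ (measurable_const.indicator hE),
          lintegral_add_right _ (measurable_const.indicator hB), lintegral_indicator_const hB,
          lintegral_indicator_const hE]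
        rfl

lemma tot_le_add_of_pos_eq (H : RankedShuffle μ m s r k σ)
    (h₀ : ∀ᵐ τ ∂μ, IsStopped m (k τ) s (j₀ τ))
    (hσ : ∀ᵐ τ ∂μ, IsStopped m (fun u => k (σ u τ) u) s (jσ τ)) (hB : MeasurableSet B)
    (hbase : IsBase m k s B θ γ h) (hθ : IsStopped m (k θ) s (j₀ θ)) (hpos : 0 < j₀ θ s)
    {ε M : ℝ} (hε : 0 ≤ ε) (hend : B.Nonempty → pos m h s = ε * j₀ θ s) (hM : j₀ θ s ≤ M)
    (hp : 1 ≤ p) :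
    Tot μ s p jσ ≤ Tot μ s p j₀ + ENNReal.ofReal ((ε * M) ^ p) +
      ENNReal.ofReal (M ^ p) * μ ({τ | r τ < r θ} \ B) := by
  have hsmall : ENNReal.ofReal (pos m h s ^ p) * μ B ≤ ENNReal.ofReal ((ε * M) ^ p) := by
    rcases B.eq_empty_or_nonempty with rfl | hne
    · simp
    · rw [hend hne]
      refine (mul_le_of_le_one_right zero_le prob_le_one).trans ?_
      gcongr
  refine (H.tot_le_add h₀ hσ hB hbase hθ hpos hp).trans ?_
  gcongr

end Comparison

section Live

variable {jη jθ : ℝ → ℝ} {η θ : T}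

lemma exists_base (H : RankedShuffle μ m s r k σ) (hη : IsStopped m (k η) s jη) (hdead : jη s = 0)
    (hθ : IsStopped m (k θ) s jθ) (hpos : 0 < jθ s) {ε : ℝ} (hε : ε ∈ Ioc 0 1) :
    ∃ γ h, IsBase m k s {τ | r τ ≤ r η} θ γ h ∧ pos m h s = ε * jθ s := by
  have hk := H.measurable_section
  have hr : r η ≤ r θ := le_of_not_gt fun hlt =>
    (hpos.trans_le (hθ.le_of_ae_le H.mem (hk θ) (hk η) hη (H.coeff_le _ _ hlt.le))).ne' hdead
  obtain ⟨b, g, hg⟩ := hη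
  obtain ⟨gθ, hgθ, heq⟩ := hθ.exists_isLive hpos
  obtain ⟨γ, h, hγ, hh, hηγ, hγθ, hend⟩ :=
    hg.exists_between H.mem (hk η) (hk θ) hdead hgθ (H.coeff_le _ _ hr) hε
  refine ⟨γ, h, ⟨hγ, hh, hγθ, fun τ hτ => ?_⟩, heq ▸ hend⟩
  filter_upwards [H.coeff_le _ _ hτ, hηγ] with u h₁ h₂ using h₁.trans h₂

lemma exists_seq_bases (H : RankedShuffle μ m s r k σ) :
    ∃ B : ℕ → Set T, (∀ n, MeasurableSet (B n)) ∧ Monotone B ∧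
      (∀ τ, IsStopped m (k τ) s (j₀ τ) → j₀ τ s = 0 → ∃ n, τ ∈ B n) ∧
      ∀ n θ, IsStopped m (k θ) s (j₀ θ) → 0 < j₀ θ s → ∀ ε ∈ Ioc (0 : ℝ) 1,
        ∃ γ h, IsBase m k s (B n) θ γ h ∧ ((B n).Nonempty → pos m h s = ε * j₀ θ s) := by
  by_cases hdead : ∃ η, IsStopped m (k η) s (j₀ η) ∧ j₀ η s = 0
  · obtain ⟨η, hη, hηmono, hηco⟩ :=
      exists_seq_cofinal (S := {η | IsStopped m (k η) s (j₀ η) ∧ j₀ η s = 0}) hdead r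
    refine ⟨fun n => {τ | r τ ≤ r (η n)},
      fun n => measurableSet_le H.measurable_rank measurable_const,
      fun a b hab τ hτ => le_trans hτ (hηmono hab), fun τ hτ hzero => hηco τ ⟨hτ, hzero⟩,
      fun n θ hθ hpos ε hε => ?_⟩
    obtain ⟨γ, h, hbase, hend⟩ := H.exists_base (hη n).1 (hη n).2 hθ hpos hε
    exact ⟨γ, h, hbase, fun _ => hend⟩
  · refine ⟨fun _ => ∅, fun _ => .empty, monotone_const,
      fun τ hτ hzero => absurd ⟨τ, hτ, hzero⟩ hdead, fun n θ hθ hpos ε _ => ?_⟩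
    obtain ⟨g, hg, -⟩ := hθ.exists_isLive hpos
    exact ⟨k θ, g, ⟨H.measurable_section θ, hg, .of_forall fun u => le_rfl,
      fun τ hτ => hτ.elim⟩, fun hne => absurd hne not_nonempty_empty⟩

end Live

lemma tot_le_of_live [IsProbabilityMeasure μ] (H : RankedShuffle μ m s r k σ)
    (h₀ : ∀ᵐ τ ∂μ, IsStopped m (k τ) s (j₀ τ))
    (hσ : ∀ᵐ τ ∂μ, IsStopped m (fun u => k (σ u τ) u) s (jσ τ))
    (hlive : ∃ θ, IsStopped m (k θ) s (j₀ θ) ∧ 0 < j₀ θ s) {p : ℝ} (hp : 1 ≤ p) :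
    Tot μ s p jσ ≤ Tot μ s p j₀ := by
  have hp0 : 0 < p := by linarith
  obtain ⟨θ, hθ, hanti, hθco⟩ :=
    exists_seq_coinitial (S := {θ | IsStopped m (k θ) s (j₀ θ) ∧ 0 < j₀ θ s}) hlive r
  obtain ⟨B, hBmeas, hBmono, hBdead, hbases⟩ := H.exists_seq_bases (j₀ := j₀)
  set M := j₀ (θ 0) s
  have hθM : ∀ n, j₀ (θ n) s ≤ M := fun n => (hθ n).1.le_of_ae_le H.mem (H.measurable_section _)
    (H.measurable_section _) (hθ 0).1 (H.coeff_le _ _ (hanti (Nat.zero_le n)))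
  set E : ℕ → Set T := fun n => {τ | r τ < r (θ n)} \ B n
  have hE : Tendsto (fun n => μ (E n)) atTop (𝓝 0) := by
    refine tendsto_measure_zero_of_antitone
      (fun n => (measurableSet_lt H.measurable_rank measurable_const).diff (hBmeas n))
      (fun a b hab τ hτ => ⟨hτ.1.trans_le (hanti hab), fun h => hτ.2 (hBmono hab h)⟩) ?_
    filter_upwards [h₀] with τ hτ
    rcases hτ.nonneg.eq_or_lt with hzero | hpos
    · exact (hBdead τ hτ hzero.symm).imp fun n hn h => h.2 hn
    · exact (hθco τ ⟨hτ, hpos⟩).imp fun n hn h => hn.not_gt h.1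
  have hbound : ∀ n : ℕ, Tot μ s p jσ ≤ Tot μ s p j₀ +
      ENNReal.ofReal ((1 / ((n : ℝ) + 1) * M) ^ p) + ENNReal.ofReal (M ^ p) * μ (E n) := by
    intro n
    have hε : (0 : ℝ) < 1 / ((n : ℝ) + 1) := Nat.one_div_pos_of_nat
    obtain ⟨γ, h, hbase, hend⟩ := hbases n (θ n) (hθ n).1 (hθ n).2 _
      ⟨hε, div_le_one_of_le₀ (by linarith [n.cast_nonneg (α := ℝ)]) (by positivity)⟩
    exact H.tot_le_add_of_pos_eq h₀ hσ (hBmeas n) hbase (hθ n).1 (hθ n).2 hε.le hend (hθM n) hp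
  have hgap : Tendsto (fun n => ENNReal.ofReal (M ^ p) * μ (E n)) atTop (𝓝 0) := by
    simpa using ENNReal.Tendsto.const_mul hE (.inr (ENNReal.ofReal_ne_top (r := M ^ p)))
  have hlim := (tendsto_const_nhds (x := Tot μ s p j₀)).add
    (tendsto_ofReal_one_div_mul_rpow M hp0) |>.add hgap
  rw [add_zero, add_zero] at hlim
  exact ge_of_tendsto' hlim hbound

section Dead

lemma ae_measure_coeff_lt_le [SFinite μ] (H : RankedShuffle μ m s r k σ) (η : T) :
    ∀ᵐ u ∂m, μ {τ | k η u < k τ u} ≤ μ {τ | r η < r τ} := by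
  filter_upwards [ae_ae_mem_imp_le (μ := μ) (g := fun _ => k η) H.measurable_coeff
    ((H.measurable_section η).comp measurable_snd)
    (measurableSet_le H.measurable_rank (measurable_const (a := r η)))
    fun τ hτ => H.coeff_le τ η hτ] with u hu
  refine measure_mono_ae (hu.mono fun τ hτ hlt => ?_)
  exact lt_of_not_ge fun hle => (hτ hle).not_gt hlt

lemma ae_tsub_mul_le_setLIntegral [IsFiniteMeasure μ] (H : RankedShuffle μ m s r k σ) {A : Set T}
    (hA : MeasurableSet A) (η : T) :
    ∀ᵐ u ∂m, (μ A - μ {τ | r η < r τ}) * (ENNReal.ofReal u * ENNReal.ofReal (-k η u)) ≤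
      ∫⁻ τ in A, ENNReal.ofReal u * ENNReal.ofReal (-k (σ u τ) u) ∂μ := by
  filter_upwards [H.ae_measure_coeff_lt_le η, H.preserving] with u hu hσu
  set V : Set T := {τ | k η u < k τ u}
  have hV : MeasurableSet V :=
    measurableSet_lt measurable_const (H.measurable_coeff.comp measurable_prodMk_right)
  have hsub : μ A - μ {τ | r η < r τ} ≤ μ (A \ σ u ⁻¹' V) := by
    refine le_trans ?_ le_measure_sdiff
    rw [hσu.measure_preimage hV.nullMeasurableSet]
    exact tsub_le_tsub_left hu _
  calc (μ A - μ {τ | r η < r τ}) * (ENNReal.ofReal u * ENNReal.ofReal (-k η u))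
      ≤ μ (A \ σ u ⁻¹' V) * (ENNReal.ofReal u * ENNReal.ofReal (-k η u)) := by gcongr
    _ = ∫⁻ _ in A \ σ u ⁻¹' V, ENNReal.ofReal u * ENNReal.ofReal (-k η u) ∂μ := by
        rw [setLIntegral_const, mul_comm]
    _ ≤ ∫⁻ τ in A \ σ u ⁻¹' V, ENNReal.ofReal u * ENNReal.ofReal (-k (σ u τ) u) ∂μ := by
        refine setLIntegral_mono' (hA.diff (hσu.measurable hV)) fun τ hτ => ?_
        have : k (σ u τ) u ≤ k η u := not_lt.1 hτ.2
        gcongr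
    _ ≤ _ := lintegral_mono_set sdiff_subset

lemma lintegral_neg_ne_top [IsFiniteMeasure μ] (H : RankedShuffle μ m s r k σ) {A : Set T}
    (hA : MeasurableSet A) {N : ℝ≥0∞} (hN : N ≠ ∞)
    (hAN : ∀ τ ∈ A, ∫⁻ u, ENNReal.ofReal u * ENNReal.ofReal (-k (σ u τ) u) ∂m ≤ N) {η : T}
    (hη : μ {τ | r η < r τ} < μ A) :
    ∫⁻ u, ENNReal.ofReal u * ENNReal.ofReal (-k η u) ∂m ≠ ∞ := by
  have hk := H.measurable_section η
  have hle : (μ A - μ {τ | r η < r τ}) * ∫⁻ u, ENNReal.ofReal u * ENNReal.ofReal (-k η u) ∂m ≤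
      N * μ A := by
    calc (μ A - μ {τ | r η < r τ}) * ∫⁻ u, ENNReal.ofReal u * ENNReal.ofReal (-k η u) ∂m
        = ∫⁻ u, (μ A - μ {τ | r η < r τ}) *
            (ENNReal.ofReal u * ENNReal.ofReal (-k η u)) ∂m :=
          (lintegral_const_mul _ (by fun_prop)).symm
      _ ≤ ∫⁻ u, ∫⁻ τ in A, ENNReal.ofReal u * ENNReal.ofReal (-k (σ u τ) u) ∂μ ∂m :=
          lintegral_mono_ae (H.ae_tsub_mul_le_setLIntegral hA η)
      _ = ∫⁻ τ in A, ∫⁻ u, ENNReal.ofReal u * ENNReal.ofReal (-k (σ u τ) u) ∂m ∂μ :=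
          lintegral_lintegral_swap H.measurable_neg_shuffled.aemeasurable.prod_swap
      _ ≤ ∫⁻ _ in A, N ∂μ := setLIntegral_mono' hA hAN
      _ = N * μ A := setLIntegral_const _ _
  intro htop
  rw [htop, ENNReal.mul_top (tsub_pos_of_lt hη).ne', top_le_iff] at hle
  exact ENNReal.mul_ne_top hN (measure_ne_top μ A) hle

lemma exists_measure_lintegral_neg_le_pos (H : RankedShuffle μ m s r k σ)
    (hσ : ∀ᵐ τ ∂μ, IsStopped m (fun u => k (σ u τ) u) s (jσ τ))
    (hlive : ¬ ∀ᵐ τ ∂μ, jσ τ s = 0) :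
    ∃ N : ℕ, 0 < μ {τ | ∫⁻ u, ENNReal.ofReal u * ENNReal.ofReal (-k (σ u τ) u) ∂m ≤ N} := by
  contrapose! hlive
  have hnull : ∀ᵐ τ ∂μ, ∀ N : ℕ,
      ¬ ∫⁻ u, ENNReal.ofReal u * ENNReal.ofReal (-k (σ u τ) u) ∂m ≤ N :=
    ae_all_iff.2 fun N => measure_eq_zero_iff_ae_notMem.1 (nonpos_iff_eq_zero.1 (hlive N))
  filter_upwards [hnull, hσ] with τ hτ hj
  by_contra hne
  obtain ⟨g, hg, -⟩ := hj.exists_isLive (hj.nonneg.lt_of_ne' hne)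
  have hfin : ∫⁻ u, ENNReal.ofReal u * ENNReal.ofReal (-k (σ u τ) u) ∂m ≠ ∞ := by
    refine ne_top_of_le_ne_top (hg.lintegral_mul_abs_ne_top H.s_pos.le H.mem) ?_
    gcongr
    exact neg_le_abs _
  obtain ⟨N, hN⟩ := ENNReal.exists_nat_gt hfin
  exact hτ N hN.le

lemma ae_exists_shuffled_le [SFinite μ] (H : RankedShuffle μ m s r k σ) {η : ℕ → T}
    (hη : ∀ᵐ τ ∂μ, ∃ n, r τ ≤ r (η n)) :
    ∀ᵐ τ ∂μ, ∀ᵐ u ∂m, ∃ n, k (σ u τ) u ≤ k (η n) u := by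
  have hcoeff : ∀ n, Measurable fun x : T × ℝ => k (η n) x.2 := fun n =>
    (H.measurable_section _).comp measurable_snd
  have hset : MeasurableSet {x : T × ℝ | ∃ n, k x.1 x.2 ≤ k (η n) x.2} := by
    simp only [ofPred_exists]
    exact .iUnion fun n => measurableSet_le H.measurable_coeff (hcoeff n)
  have hsetσ : MeasurableSet {x : T × ℝ | ∃ n, k (σ x.2 x.1) x.2 ≤ k (η n) x.2} := by
    simp only [ofPred_exists]
    exact .iUnion fun n => measurableSet_le H.measurable_shuffled (hcoeff n)
  have hunshuffled : ∀ᵐ u ∂m, ∀ᵐ τ ∂μ, ∃ n, k τ u ≤ k (η n) u :=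
    (Measure.ae_ae_comm hset).1 <| hη.mono fun τ ⟨n, hn⟩ =>
      (H.coeff_le _ _ hn).mono fun u hu => ⟨n, hu⟩
  refine (Measure.ae_ae_comm hsetσ).2 ?_
  filter_upwards [hunshuffled, H.preserving] with u hu hσu
  exact hσu.quasiMeasurePreserving.ae hu

lemma ae_eq_zero_of_dead [IsProbabilityMeasure μ] (H : RankedShuffle μ m s r k σ)
    (h₀ : ∀ᵐ τ ∂μ, IsStopped m (k τ) s (j₀ τ))
    (hσ : ∀ᵐ τ ∂μ, IsStopped m (fun u => k (σ u τ) u) s (jσ τ))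
    (hdead : ∀ τ, IsStopped m (k τ) s (j₀ τ) → j₀ τ s ≤ 0) : ∀ᵐ τ ∂μ, jσ τ s = 0 := by
  by_contra hlive
  obtain ⟨N, hN⟩ := H.exists_measure_lintegral_neg_le_pos hσ hlive
  obtain ⟨η, hη, hmono, hco, hlt⟩ := H.exists_seq_cofinal_measure_lt h₀ hN
  have hneg : ∫⁻ u, ENNReal.ofReal u * ENNReal.ofReal (-k (η 0) u) ∂m ≠ ∞ :=
    H.lintegral_neg_ne_top
      (measurableSet_le H.measurable_neg_shuffled.lintegral_prod_right' measurable_const)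
      (ENNReal.natCast_ne_top N) (fun τ hτ => hτ) hlt
  apply hlive
  filter_upwards [hσ, H.ae_exists_shuffled_le hco] with τ hτ hle
  by_contra hne
  obtain ⟨g, hg, -⟩ := hτ.exists_isLive (hτ.nonneg.lt_of_ne' hne)
  obtain ⟨n, hn⟩ := hg.exists_pos_of_eventually_le H.s_pos H.mem
    (H.measurable_shuffled_section τ) (fun n => H.measurable_section (η n))
    (H.ae_monotone_coeff hmono) hle hneg hη
  exact hn.not_ge (hdead _ (hη n))

end Dead

lemma tot_le [IsProbabilityMeasure μ] (H : RankedShuffle μ m s r k σ)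
    (h₀ : ∀ᵐ τ ∂μ, IsStopped m (k τ) s (j₀ τ))
    (hσ : ∀ᵐ τ ∂μ, IsStopped m (fun u => k (σ u τ) u) s (jσ τ)) {p : ℝ} (hp : 1 ≤ p) :
    Tot μ s p jσ ≤ Tot μ s p j₀ := by
  by_cases hlive : ∃ θ, IsStopped m (k θ) s (j₀ θ) ∧ 0 < j₀ θ s
  · exact H.tot_le_of_live h₀ hσ hlive hp
  · push Not at hlive
    rw [tot_eq_zero (by linarith) (H.ae_eq_zero_of_dead h₀ hσ hlive)]
    exact zero_le

end RankedShuffle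

end Families

section MonotoneFamilies

variable {T : Type*}

/-- A numerical invariant that orders the members of a monotone family; the bounded increasing
function `arctan` makes every coefficient integrable against a finite measure. -/
def rank (m : Measure ℝ) (k : T → ℝ → ℝ) (τ : T) : ℝ := ∫ u, Real.arctan (k τ u) ∂m

lemma integrable_arctan {m : Measure ℝ} [IsFiniteMeasure m] {f : ℝ → ℝ} (hf : Measurable f) :
    Integrable (fun u => Real.arctan (f u)) m :=
  .of_bound (Real.measurable_arctan.comp hf).aestronglyMeasurable (Real.pi / 2) <|
    .of_forall fun _ =>
      abs_le.2 ⟨(Real.neg_pi_div_two_lt_arctan _).le, (Real.arctan_lt_pi_div_two _).le⟩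

lemma ae_eq_of_ae_le_of_integral_arctan_le {m : Measure ℝ} [IsFiniteMeasure m] {f g : ℝ → ℝ}
    (hf : Measurable f) (hg : Measurable g) (hfg : f ≤ᵐ[m] g)
    (h : ∫ u, Real.arctan (g u) ∂m ≤ ∫ u, Real.arctan (f u) ∂m) : f =ᵐ[m] g := by
  have hle : (fun u => Real.arctan (f u)) ≤ᵐ[m] fun u => Real.arctan (g u) :=
    hfg.mono fun u hu => Real.arctan_mono hu
  have heq := (integral_eq_iff_of_ae_le (integrable_arctan hf) (integrable_arctan hg) hle).1
    ((integral_mono_ae (integrable_arctan hf) (integrable_arctan hg) hle).antisymm h)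
  exact heq.mono fun u hu => Real.arctan_injective hu

lemma IsMonotoneFamily.ae_le_of_rank_le {m : Measure ℝ} [IsFiniteMeasure m] {k : T → ℝ → ℝ}
    {t₀ : ℝ} (hmono : IsMonotoneFamily t₀ k) (hk : ∀ τ, Measurable (k τ))
    (hm : ∀ᵐ u ∂m, u ∈ Icc 0 t₀) {τ τ' : T} (h : rank m k τ ≤ rank m k τ') :
    ∀ᵐ u ∂m, k τ u ≤ k τ' u := by
  by_cases hlt : ∃ u ∈ Icc 0 t₀, k τ' u < k τ u
  · have hle : k τ' ≤ᵐ[m] k τ := hm.mono (hmono τ τ' hlt)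
    exact (ae_eq_of_ae_le_of_integral_arctan_le (hk τ') (hk τ) hle h).symm.le
  · push Not at hlt
    exact hm.mono hlt

variable [MeasurableSpace T]

lemma measurable_rank {m : Measure ℝ} [SFinite m] {k : T → ℝ → ℝ}
    (hk : Measurable fun x : T × ℝ => k x.1 x.2) : Measurable (rank m k) :=
  (StronglyMeasurable.integral_prod_right' (f := fun x : T × ℝ => Real.arctan (k x.1 x.2))
    (Real.measurable_arctan.comp hk).stronglyMeasurable).measurable

lemma IsMonotoneFamily.rankedShuffle {μ : Measure T} {t₀ : ℝ} {σ : ℝ → T → T}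
    {k : T → ℝ → ℝ} (hmono : IsMonotoneFamily t₀ k)
    (hk : Measurable fun x : T × ℝ => k x.1 x.2) (hσ : IsShuffle μ t₀ σ) (ν : Measure ℝ)
    [IsLocallyFiniteMeasure ν] {s : ℝ} (hs : s ∈ Ioc 0 t₀) :
    RankedShuffle μ (ν.restrict (Ioc 0 s)) s (rank (ν.restrict (Ioc 0 s)) k) k σ := by
  have hmem : ∀ᵐ u ∂ν.restrict (Ioc 0 s), u ∈ Ioc 0 s := ae_restrict_mem measurableSet_Ioc
  have hmem' : ∀ᵐ u ∂ν.restrict (Ioc 0 s), u ∈ Icc 0 t₀ :=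
    hmem.mono fun u hu => ⟨hu.1.le, hu.2.trans hs.2⟩
  have : IsFiniteMeasure (ν.restrict (Ioc 0 s)) :=
    isFiniteMeasure_restrict.2 measure_Ioc_lt_top.ne
  exact
    { s_pos := hs.1
      mem := hmem
      measurable_rank := measurable_rank hk
      measurable_coeff := hk
      coeff_le := fun τ τ' h =>
        hmono.ae_le_of_rank_le (fun τ => hk.comp measurable_prodMk_left) hmem' h
      measurable_shuffle := hσ.measurable
      preserving := hmem'.mono fun u hu => hσ.preserving u hu }

lemma IsStoppedSolution.apply_zero {ν : Measure ℝ} {t₀ : ℝ} {k j : ℝ → ℝ}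
    (h : IsStoppedSolution ν k t₀ j) : j 0 = 0 := by
  obtain ⟨b, hb, ⟨v, hv⟩, -⟩ := h
  rw [hv.position 0 ⟨le_rfl, hb.1.le⟩, intervalIntegral.integral_same]

theorem tot_shuffled_le {μ : Measure T} [IsProbabilityMeasure μ] {t₀ : ℝ} {σ : ℝ → T → T}
    (hσ : IsShuffle μ t₀ σ) {ν : Measure ℝ} [IsLocallyFiniteMeasure ν] {k : T → ℝ → ℝ}
    (hk : Measurable fun x : T × ℝ => k x.1 x.2) (hmono : IsMonotoneFamily t₀ k)
    {j₀ jσ : T → ℝ → ℝ} (h₀ : IsSolutionFamily μ ν t₀ k j₀)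
    (h₁ : IsSolutionFamily μ ν t₀ (shuffled σ k) jσ) {s : ℝ} (hs : s ∈ Icc 0 t₀) {p : ℝ}
    (hp : 1 ≤ p) : Tot μ s p jσ ≤ Tot μ s p j₀ := by
  rcases hs.1.eq_or_lt with rfl | hs₀
  · rw [tot_eq_zero (by linarith) (h₁.mono fun τ hτ => hτ.apply_zero)]
    exact zero_le
  · have hs' : s ∈ Ioc 0 t₀ := ⟨hs₀, hs.2⟩
    exact (hmono.rankedShuffle hk hσ ν hs').tot_le (h₀.mono fun τ hτ => hτ.isStopped hs')
      (h₁.mono fun τ hτ => hτ.isStopped hs') hp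

end MonotoneFamilies

end JacobiShuffle

end

theorem theorem1 {T : Type*} [MeasurableSpace T] (μ : MeasureTheory.Measure T)
    [MeasureTheory.IsProbabilityMeasure μ] (t₀ : ℝ) (σ : ℝ → T → T)
    (hσ : JacobiShuffle.IsShuffle μ t₀ σ) :
    -- monotone families
    (∀ (ν : MeasureTheory.Measure ℝ) [MeasureTheory.IsLocallyFiniteMeasure ν] (k : T → ℝ → ℝ),
      Measurable (fun x : T × ℝ => k x.1 x.2) →
      JacobiShuffle.IsMonotoneFamily t₀ k →
      ∀ j₀ jσ : T → ℝ → ℝ,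
        JacobiShuffle.IsSolutionFamily μ ν t₀ k j₀ →
        JacobiShuffle.IsSolutionFamily μ ν t₀ (JacobiShuffle.shuffled σ k) jσ →
        ∀ s ∈ Set.Icc 0 t₀, ∀ p : ℝ, 1 ≤ p →
          JacobiShuffle.Tot μ s p jσ ≤ JacobiShuffle.Tot μ s p j₀) ∧
    -- constant coefficients
    (∀ c : T → ℝ, Measurable c →
      ∀ j₀ jσ : T → ℝ → ℝ,
        JacobiShuffle.IsSolutionFamily μ MeasureTheory.volume t₀ (fun τ _ => c τ) j₀ →
        JacobiShuffle.IsSolutionFamily μ MeasureTheory.volume t₀ (fun τ t => c (σ t τ)) jσ →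
        ∀ s ∈ Set.Icc 0 t₀, ∀ p : ℝ, 1 ≤ p →
          JacobiShuffle.Tot μ s p jσ ≤ JacobiShuffle.Tot μ s p j₀) := by
  refine ⟨fun ν _ k hk hmono j₀ jσ h₀ h₁ s hs p hp =>
    JacobiShuffle.tot_shuffled_le hσ hk hmono h₀ h₁ hs hp,
    fun c hc j₀ jσ h₀ h₁ s hs p hp => ?_⟩
  exact JacobiShuffle.tot_shuffled_le hσ (k := fun τ _ => c τ) (hc.comp measurable_fst)
    (fun _ _ ⟨_, _, h⟩ _ _ => h.le) h₀ h₁ hs hp
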